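/- For $f\in L^1(\mathbb R)$ write $\hat f(\xi)=\int_{\mathbb R} f(x)e^{-2\pi i\xi x}\,dx$. Let $\varphi\in\mathcal S(\mathbb R)$ be a (real- or complex-valued) Schwartz function, let $\varepsilon>0$, and put $\varphi_\varepsilon(x)=\frac1\varepsilon\varphi(x/\varepsilon)$. Suppose that for every $\xi\in\mathbb R$ the number $\widehat{\varphi_\varepsilon}(\xi)$ is real and $0<\widehat{\varphi_\varepsilon}(\xi)<2$. Let $T_\varepsilon(f)=f*\varphi_\varepsilon$, where for a tempered distribution $f\in\mathcal S'(\mathbb R)$ the convolution is defined by $\langle f*\varphi_\varepsilon,\psi\rangle=\langle f,\check\varphi_\varepsilon*\psi\rangle$ for $\psi\in\mathcal S(\mathbb R)$, with $\check\varphi_\varepsilon(x)=\varphi_\varepsilon(-x)$. For $n\in\mathbb N$ let $$T_{\varepsilon,n}^{-1}(f)=\sum_{k=0}^{n}(-1)^k\binom{n+1}{k+1}T_\varepsilon^k(f),$$ where $T_\varepsilon^k$ is the $k$-fold composition of $T_\varepsilon$ with itself and $T_\varepsilon^0$ is the identity. Functions and distributions are complex-valued, and $\mathcal S'(\mathbb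 R)$ carries the weak-$*$ topology. Then: 1. If $f\in L^2(\mathbb R)$, then for every $k$ the function $T_\varepsilon^k(f)$ is well defined and lies in $L^2(\mathbb R)$, and $T_{\varepsilon,n}^{-1}(T_\varepsilon(f))\to f$ in $L^2(\mathbb R)$ as $n\to\infty$. 2. If $f\in L^1(\mathbb R)$ and $\hat f\in L^1(\mathbb R)$, then for every $k$ the function $T_\varepsilon^k(f)$ is well defined and lies in $L^1(\mathbb R)$, and $T_{\varepsilon,n}^{-1}(T_\varepsilon(f))$ converges pointwise to $f$ as $n\to\infty$, in the following sense: $f$ agrees almost everywhere with a continuous function $g$, and $T_{\varepsilon,n}^{-1}(T_\varepsilon(f))(x)\to g(x)$ for every $x\in\mathbb R$. In particular the limit is $f(x)$ for almost every $x$ and at every point $x$ at which $f$ is continuous. 3. Let $u\in\mathcal S'(\mathbb R)$ be one of the following: the distribution $\mathbb 1$, given by $\langle\mathbb 1,\psi\rangle=\int_{\mathbb R}\psi$; the Dirac distribution $\delta$ at $0$; the Cauchy principal value $\mathrm{pv}\frac1x$, given by $\langle\mathrm{pv}\frac1x,\psi\rangle=\lim_{\eta\to0^+}\int_{|x|>\eta}\frac{\psi(x)}{x}\,dx$;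 or the distribution defined by the function $x\mapsto e^{2\pi iyx}$ for some $y\in\mathbb R$. Then $T_{\varepsilon,n}^{-1}(T_\varepsilon(u))\to u$ in $\mathcal S'(\mathbb R)$ as $n\to\infty$. The same holds for every finite complex linear combination $u$ of translates of these distributions. 4. Suppose that $\varphi$ is the Gaussian kernel $\varphi(x)=\frac{1}{\sqrt{4\pi}}e^{-(x/2)^2}$. Then $T_{\varepsilon,n}^{-1}(T_\varepsilon(f))\to f$ as $n\to\infty$ in the topology of $\mathcal S(\mathbb R)$ for every $f\in\mathcal S(\mathbb R)$, and in $\mathcal S'(\mathbb R)$ for every $f\in\mathcal S'(\mathbb R)$. -/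

import Mathlib

open MeasureTheory Filter Topology
open scoped SchwartzMap FourierTransform Convolution ENNReal

noncomputable section

namespace Deconvolution

/-- The dilation `φ_ε = ε⁻¹ φ(· / ε)` of a Schwartz function. -/
def dilate (ε : ℝ) (hε : 0 < ε) (φ : 𝓢(ℝ, ℂ)) : 𝓢(ℝ, ℂ) :=
  ((ε⁻¹ : ℝ) : ℂ) • SchwartzMap.compCLMOfContinuousLinearEquiv ℂ
    (ContinuousLinearEquiv.unitsEquivAut ℝ (Units.mk0 ε⁻¹ (inv_ne_zero hε.ne'))) φ

theorem dilate_apply (ε : ℝ) (hε : 0 < ε) (φ : 𝓢(ℝ, ℂ)) (x : ℝ) :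
    dilate ε hε φ x = ((1 / ε : ℝ) : ℂ) * φ (x / ε) := by
  simp [dilate, div_eq_mul_inv]

/-- The reflection `x ↦ g (-x)` of a Schwartz function. -/
def reflect (g : 𝓢(ℝ, ℂ)) : 𝓢(ℝ, ℂ) :=
  SchwartzMap.compCLMOfContinuousLinearEquiv ℂ (ContinuousLinearEquiv.neg ℝ) g

theorem reflect_apply (g : 𝓢(ℝ, ℂ)) (x : ℝ) : reflect g x = g (-x) := by
  simp [reflect]

/-- Convolution `f ↦ f * g` of a function on the line with a Schwartz kernel `g`. -/
def convFun (g : 𝓢(ℝ, ℂ)) (f : ℝ → ℂ) : ℝ → ℂ :=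
  f ⋆[ContinuousLinearMap.mul ℂ ℂ, volume] (g : ℝ → ℂ)

theorem convFun_apply (g : 𝓢(ℝ, ℂ)) (f : ℝ → ℂ) (x : ℝ) :
    convFun g f x = ∫ s, f (x - s) * g s := by
  simp [convFun, convolution_eq_swap]

/-- Convolution `f ↦ f * g` on the Schwartz space. -/
def convSchwartz (g f : 𝓢(ℝ, ℂ)) : 𝓢(ℝ, ℂ) :=
  SchwartzMap.convolution (ContinuousLinearMap.mul ℂ ℂ) f g

theorem coe_convSchwartz (g f : 𝓢(ℝ, ℂ)) :
    (convSchwartz g f : ℝ → ℂ) = convFun g f := by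
  ext x
  exact SchwartzMap.convolution_apply _ f g x

/-- Convolution `u ↦ u * g` on the tempered distributions, the transpose of `ψ ↦ ǧ * ψ`. -/
def convTempered (g : 𝓢(ℝ, ℂ)) : 𝓢'(ℝ, ℂ) →L[ℂ] 𝓢'(ℝ, ℂ) :=
  PointwiseConvergenceCLM.precomp ℂ
    (SchwartzMap.convolution (ContinuousLinearMap.mul ℂ ℂ) (reflect g))

theorem convTempered_apply (g : 𝓢(ℝ, ℂ)) (u : 𝓢'(ℝ, ℂ)) (ψ : 𝓢(ℝ, ℂ)) :
    convTempered g u ψ = u (convSchwartz ψ (reflect g)) := rfl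

/-- The `n`-th approximate inverse `f ↦ ∑_{k=0}^n (-1)^k C(n+1, k+1) T^k f` of an operator `T`,
where `T^k` is the `k`-fold composition. -/
def approxInv {M : Type*} [AddCommGroup M] [Module ℂ M] (T : M → M) (n : ℕ) (f : M) : M :=
  ∑ k ∈ Finset.range (n + 1), ((-1 : ℂ) ^ k * ((n + 1).choose (k + 1) : ℂ)) • T^[k] f

/-- The tempered distribution `ψ ↦ ∫ ψ`. -/
def oneDist : 𝓢'(ℝ, ℂ) := (volume : Measure ℝ).toTemperedDistribution

theorem oneDist_apply (ψ : 𝓢(ℝ, ℂ)) : oneDist ψ = ∫ x, ψ x := rfl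

theorem hasTemperateGrowth_character (y : ℝ) :
    (fun x : ℝ ↦ Complex.exp (2 * Real.pi * Complex.I * y * x)).HasTemperateGrowth := by
  set c : ℂ := 2 * Real.pi * Complex.I * y with hc
  have hre : ∀ x : ℝ, ‖Complex.exp (c * x)‖ = 1 := by
    intro x
    have : c * x = ((2 * Real.pi * y * x : ℝ) : ℂ) * Complex.I := by
      rw [hc]; push_cast; ring
    rw [this, Complex.norm_exp_ofReal_mul_I]
  have hder : ∀ n : ℕ, iteratedDeriv n (fun x : ℝ ↦ Complex.exp (c * x))
      = fun x : ℝ ↦ c ^ n * Complex.exp (c * x) := by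
    intro n
    induction n with
    | zero => simp
    | succ n ih =>
      rw [iteratedDeriv_succ, ih]
      ext x
      have h1 : HasDerivAt (fun x : ℝ ↦ c * (x : ℂ)) (c * 1) x :=
        (Complex.ofRealCLM.hasDerivAt (x := x)).const_mul c
      have h2 := (h1.cexp).const_mul (c ^ n)
      rw [h2.deriv]
      ring
  refine ⟨(contDiff_const.mul Complex.ofRealCLM.contDiff).cexp, fun n ↦ ⟨0, ‖c‖ ^ n, fun x ↦ ?_⟩⟩
  rw [norm_iteratedFDeriv_eq_norm_iteratedDeriv, hder n]
  simp [hre]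

/-- The tempered distribution given by the function `x ↦ e^{2πiyx}`. -/
def characterDist (y : ℝ) : 𝓢'(ℝ, ℂ) :=
  (hasTemperateGrowth_character y).toTemperedDistribution volume

theorem characterDist_apply (y : ℝ) (ψ : 𝓢(ℝ, ℂ)) :
    characterDist y ψ = ∫ x : ℝ, ψ x * Complex.exp (2 * Real.pi * Complex.I * y * x) := rfl

theorem norm_pvIntegrand_le (ψ : 𝓢(ℝ, ℂ)) (x : ℝ) (hx : 0 < x) :
    ‖(ψ x - ψ (-x)) / (x : ℂ)‖ ≤
      4 * (SchwartzMap.seminorm ℂ 0 1 ψ + SchwartzMap.seminorm ℂ 1 0 ψ) * (1 + x ^ 2)⁻¹ := by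
  have hS0 : 0 ≤ SchwartzMap.seminorm ℂ 0 1 ψ := apply_nonneg _ _
  have hS1 : 0 ≤ SchwartzMap.seminorm ℂ 1 0 ψ := apply_nonneg _ _
  have hd : ‖ψ x - ψ (-x)‖ ≤ SchwartzMap.seminorm ℂ 0 1 ψ * (2 * x) := by
    have := Convex.norm_image_sub_le_of_norm_deriv_le (f := ψ) (s := Set.univ) (x := -x) (y := x)
      (C := SchwartzMap.seminorm ℂ 0 1 ψ) (fun z _ ↦ ψ.differentiableAt)
      (fun z _ ↦ by simpa using SchwartzMap.le_seminorm' ℂ 0 1 ψ z)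
      convex_univ (Set.mem_univ _) (Set.mem_univ _)
    refine this.trans (le_of_eq ?_)
    rw [Real.norm_eq_abs, abs_of_pos (by linarith)]
    ring
  have hx1 : x * ‖ψ x‖ ≤ SchwartzMap.seminorm ℂ 1 0 ψ := by
    simpa [abs_of_pos hx] using SchwartzMap.le_seminorm' ℂ 1 0 ψ x
  have hx2 : x * ‖ψ (-x)‖ ≤ SchwartzMap.seminorm ℂ 1 0 ψ := by
    simpa [abs_of_pos hx] using SchwartzMap.le_seminorm' ℂ 1 0 ψ (-x)
  have hs : ‖ψ x - ψ (-x)‖ ≤ ‖ψ x‖ + ‖ψ (-x)‖ := norm_sub_le _ _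
  rw [norm_div, Complex.norm_real, Real.norm_eq_abs, abs_of_pos hx, div_le_iff₀ hx,
    ← div_eq_mul_inv, div_mul_eq_mul_div, le_div_iff₀ (by positivity)]
  rcases le_total x 1 with h | h
  · have h2 : x ^ 2 ≤ 1 := by nlinarith
    have := norm_nonneg (ψ x - ψ (-x))
    have h3 : 0 ≤ SchwartzMap.seminorm ℂ 1 0 ψ * x := by positivity
    have h4 : 0 ≤ ‖ψ x - ψ (-x)‖ * (1 - x ^ 2) := mul_nonneg this (by linarith)
    nlinarith
  · have h3 : 0 ≤ SchwartzMap.seminorm ℂ 0 1 ψ * x := by positivity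
    have h5 : x * ‖ψ x - ψ (-x)‖ ≤ 2 * SchwartzMap.seminorm ℂ 1 0 ψ := by
      nlinarith [mul_le_mul_of_nonneg_left hs hx.le]
    have h6 : ‖ψ x - ψ (-x)‖ ≤ x * (x * ‖ψ x - ψ (-x)‖) := by
      have := norm_nonneg (ψ x - ψ (-x))
      nlinarith [mul_nonneg this (by nlinarith : 0 ≤ x ^ 2 - 1)]
    nlinarith [mul_le_mul_of_nonneg_left h5 hx.le]

theorem integrableOn_pvIntegrand (ψ : 𝓢(ℝ, ℂ)) :
    IntegrableOn (fun x : ℝ ↦ (ψ x - ψ (-x)) / (x : ℂ)) (Set.Ioi 0) := by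
  refine Integrable.mono' ((integrable_inv_one_add_sq.const_mul
    (4 * (SchwartzMap.seminorm ℂ 0 1 ψ + SchwartzMap.seminorm ℂ 1 0 ψ))).integrableOn) ?_ ?_
  · have h : Measurable fun x : ℝ ↦ (ψ x - ψ (-x)) / (x : ℂ) :=
      ((ψ.continuous.measurable).sub ((ψ.continuous.comp continuous_neg).measurable)).div
        Complex.measurable_ofReal
    exact h.aestronglyMeasurable
  · filter_upwards [ae_restrict_mem measurableSet_Ioi] with x hx
    exact norm_pvIntegrand_le ψ x hx

/-- The Cauchy principal value `pv (1/x)`, as a tempered distribution. Symmetrising the truncated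
integrals `∫_{|x| > η} ψ(x) / x dx` turns their limit as `η → 0⁺` into the absolutely convergent
integral below; see `tendsto_pvDist`. -/
def pvDist : 𝓢'(ℝ, ℂ) :=
  ContinuousLinearMap.toPointwiseConvergenceCLM _ _ _ _ <|
    SchwartzMap.mkCLMtoNormedSpace (𝕜 := ℂ) (σ := RingHom.id ℂ)
      (fun ψ : 𝓢(ℝ, ℂ) ↦ ∫ x in Set.Ioi (0 : ℝ), (ψ x - ψ (-x)) / (x : ℂ))
      (fun f g ↦ by
        rw [← integral_add (integrableOn_pvIntegrand f) (integrableOn_pvIntegrand g)]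
        refine integral_congr_ae (ae_of_all _ fun x ↦ ?_)
        simp only [add_apply]
        ring)
      (fun a f ↦ by
        rw [RingHom.id_apply, ← integral_smul]
        refine integral_congr_ae (ae_of_all _ fun x ↦ ?_)
        simp only [smul_apply, smul_eq_mul]
        ring)
      (by
        refine ⟨{(0, 1), (1, 0)}, 8 * ∫ x : ℝ, (1 + x ^ 2)⁻¹,
          mul_nonneg (by norm_num) (integral_nonneg fun x ↦ by positivity), fun f ↦ ?_⟩
        have h1 : SchwartzMap.seminorm ℂ 0 1 f ≤
            (({(0, 1), (1, 0)} : Finset (ℕ × ℕ)).sup (schwartzSeminormFamily ℂ ℝ ℂ)) f :=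
          Seminorm.le_finset_sup_apply (p := schwartzSeminormFamily ℂ ℝ ℂ) (i := (0, 1))
            (by simp)
        have h2 : SchwartzMap.seminorm ℂ 1 0 f ≤
            (({(0, 1), (1, 0)} : Finset (ℕ × ℕ)).sup (schwartzSeminormFamily ℂ ℝ ℂ)) f :=
          Seminorm.le_finset_sup_apply (p := schwartzSeminormFamily ℂ ℝ ℂ) (i := (1, 0))
            (by simp)
        have hS0 : 0 ≤ SchwartzMap.seminorm ℂ 0 1 f := apply_nonneg _ _
        have hS1 : 0 ≤ SchwartzMap.seminorm ℂ 1 0 f := apply_nonneg _ _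
        have hI := integrable_inv_one_add_sq.const_mul
            (4 * (SchwartzMap.seminorm ℂ 0 1 f + SchwartzMap.seminorm ℂ 1 0 f))
        calc _ ≤ ∫ x in Set.Ioi (0 : ℝ), 4 * (SchwartzMap.seminorm ℂ 0 1 f +
                SchwartzMap.seminorm ℂ 1 0 f) * (1 + x ^ 2)⁻¹ := by
              refine norm_integral_le_of_norm_le hI.integrableOn ?_
              filter_upwards [ae_restrict_mem measurableSet_Ioi] with x hx
              exact norm_pvIntegrand_le f x hx
          _ ≤ ∫ x : ℝ, 4 * (SchwartzMap.seminorm ℂ 0 1 f +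
                SchwartzMap.seminorm ℂ 1 0 f) * (1 + x ^ 2)⁻¹ :=
              setIntegral_le_integral hI (ae_of_all _ fun x ↦ by positivity)
          _ = 4 * (SchwartzMap.seminorm ℂ 0 1 f + SchwartzMap.seminorm ℂ 1 0 f) *
                ∫ x : ℝ, (1 + x ^ 2)⁻¹ := integral_const_mul _ _
          _ ≤ _ := by
              have h0 : 0 ≤ ∫ x : ℝ, (1 + x ^ 2)⁻¹ := integral_nonneg fun x ↦ by positivity
              nlinarith)

theorem pvDist_apply (ψ : 𝓢(ℝ, ℂ)) :
    pvDist ψ = ∫ x in Set.Ioi (0 : ℝ), (ψ x - ψ (-x)) / (x : ℂ) := rfl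

theorem tendsto_pvDist (ψ : 𝓢(ℝ, ℂ)) :
    Tendsto (fun η : ℝ ↦ ∫ x in {x : ℝ | η < |x|}, ψ x / (x : ℂ)) (𝓝[>] 0)
      (𝓝 (pvDist ψ)) := by
  have key : ∀ η : ℝ, 0 < η → ∫ x in {x : ℝ | η < |x|}, ψ x / (x : ℂ) =
      ∫ x in Set.Ioi η, (ψ x - ψ (-x)) / (x : ℂ) := by
    intro η hη
    have hset : {x : ℝ | η < |x|} = Set.Iio (-η) ∪ Set.Ioi η := by
      ext x
      simp only [Set.mem_ofPred_eq, Set.mem_union, Set.mem_Iio, Set.mem_Ioi, lt_abs]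
      constructor
      · rintro (h | h)
        · exact Or.inr h
        · exact Or.inl (by linarith)
      · rintro (h | h)
        · exact Or.inr (by linarith)
        · exact Or.inl h
    have hmeas : Measurable fun x : ℝ ↦ ψ x / (x : ℂ) :=
      ψ.continuous.measurable.div Complex.measurable_ofReal
    have hint : IntegrableOn (fun x : ℝ ↦ ψ x / (x : ℂ)) {x : ℝ | η < |x|} := by
      refine Integrable.mono' (g := fun x ↦ η⁻¹ * ‖ψ x‖)
        ((ψ.integrable.norm.const_mul _).integrableOn) hmeas.aestronglyMeasurable ?_
      have hms : MeasurableSet {x : ℝ | η < |x|} :=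
        measurableSet_lt measurable_const continuous_abs.measurable
      filter_upwards [ae_restrict_mem hms] with x hx
      have hx' : η < |x| := hx
      rw [norm_div, Complex.norm_real, Real.norm_eq_abs, div_eq_inv_mul]
      gcongr
    rw [hset] at hint
    have hL := hint.mono_set (Set.subset_union_left)
    have hR := hint.mono_set (Set.subset_union_right)
    have hneg : ∫ x in Set.Ioi η, ψ (-x) / ((-x : ℝ) : ℂ) = ∫ x in Set.Iio (-η), ψ x / (x : ℂ) := by
      rw [integral_comp_neg_Ioi η (fun x : ℝ ↦ ψ x / (x : ℂ)), integral_Iic_eq_integral_Iio]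
    have hnegint : IntegrableOn (fun x : ℝ ↦ ψ (-x) / ((-x : ℝ) : ℂ)) (Set.Ioi η) := by
      have := (integrable_indicator_iff measurableSet_Iio).2 hL
      have h2 := this.comp_neg
      rw [← integrable_indicator_iff measurableSet_Ioi]
      refine h2.congr (ae_of_all _ fun x ↦ ?_)
      by_cases hx : η < x
      · simp [Set.indicator, hx]
      · simp [Set.indicator, hx]
    rw [hset, setIntegral_union _ measurableSet_Ioi hL hR, ← hneg, add_comm,
      ← integral_add hR hnegint]
    · refine integral_congr_ae (ae_of_all _ fun x ↦ ?_)
      simp only [Complex.ofReal_neg, div_neg]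
      ring
    · refine Set.disjoint_left.2 fun x hx hx' ↦ ?_
      simp only [Set.mem_Iio, Set.mem_Ioi] at hx hx'
      linarith
  have hconv : Tendsto (fun η : ℝ ↦ ∫ x in Set.Ioi η, (ψ x - ψ (-x)) / (x : ℂ)) (𝓝[>] 0)
      (𝓝 (∫ x in Set.Ioi (0 : ℝ), (ψ x - ψ (-x)) / (x : ℂ))) :=
    (aecover_Ioi_of_Ioi (μ := volume) (tendsto_id.mono_left nhdsWithin_le_nhds)
      ).integral_tendsto_of_countably_generated (integrableOn_pvIntegrand ψ) |>.congr' <| by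
      filter_upwards [self_mem_nhdsWithin] with η hη
      have hη' : (0 : ℝ) < η := hη
      rw [Measure.restrict_restrict measurableSet_Ioi, Set.Ioi_inter_Ioi]
      simp [hη'.le]
  rw [pvDist_apply]
  refine hconv.congr' ?_
  filter_upwards [self_mem_nhdsWithin] with η hη
  exact (key η hη).symm

/-- The translate of a tempered distribution `u` by `a`, so that a function `x ↦ u(x)` is sent to
`x ↦ u(x - a)`. -/
def translateDist (a : ℝ) (u : 𝓢'(ℝ, ℂ)) : 𝓢'(ℝ, ℂ) :=
  PointwiseConvergenceCLM.precomp ℂ (SchwartzMap.compSubConstCLM ℂ (-a)) u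

theorem translateDist_apply (a : ℝ) (u : 𝓢'(ℝ, ℂ)) (ψ : 𝓢(ℝ, ℂ)) :
    translateDist a u ψ = u (SchwartzMap.compSubConstCLM ℂ (-a) ψ) := rfl

/-- The distributions `1`, `δ`, `pv (1/x)` and `e^{2πiyx}` for `y ∈ ℝ`. -/
def basicDists : Set 𝓢'(ℝ, ℂ) :=
  {oneDist, TemperedDistribution.delta 0, pvDist} ∪ Set.range characterDist

end Deconvolution

end

open Deconvolution

noncomputable section

namespace Deconvolution

/-! ### The approximate inverse as a residual power -/

/-! Write `T` for convolution with the kernel `g`. By the binomial theorem, applying the `n`-th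
approximate inverse after `T` gives `1 - (1 - T)^(n+1)`, so every claim says that the residual
powers `(1 - T)^n` tend to zero. On the Fourier side `(1 - T)^n` is multiplication by `(1 - 𝓕 g)^n`,
and `0 < 𝓕 g < 2` means `|1 - 𝓕 g| < 1` at each point. The bound is not uniform, since `𝓕 g`
vanishes at infinity; dominated convergence replaces a geometric rate
(`tendsto_integral_norm_pow_mul`).

In `L²`, Plancherel settles Schwartz functions, and density with the contraction property settles
the rest. If `f` and `𝓕 f` are integrable, the sup norm of the residual of the continuous
representative is at most the `L¹` norm of its transform. For distributions the residual moves by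
transposition to the test function; each basic distribution is controlled by a quantity that decays
there: a value of the Fourier transform, a sup norm, or a derivative bound with an `L²` norm.

For a Gaussian, convergence holds in `𝓢` itself. With `m = exp (-a ξ²)`, the power `(1 - m)^n` is a
Bernstein polynomial in `m`. As `m' = -2aξ m`, differentiation gives Bernstein polynomials again,
with coefficients free of `n` (`hasDerivAt_bernsteinValue_comp`). They are at most one and vanish
locally uniformly, and Schwartz decay handles the tails. -/

/-- For a linear operator `L`, the error of the approximate inverse is a power of `1 - L`. -/
theorem approxInv_linear_apply {M : Type*} [AddCommGroup M] [Module ℂ M] (L : Module.End ℂ M)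
    (n : ℕ) (v : M) : approxInv L n (L v) = v - ((1 - L) ^ (n + 1)) v := by
  have h : (1 - L) ^ (n + 1) =
      1 - ∑ k ∈ Finset.range (n + 1),
        ((-1 : ℂ) ^ k * ((n + 1).choose (k + 1) : ℂ)) • L ^ (k + 1) := by
    -- The index-zero term of the expansion is the leading `1`; splitting it off shifts the others
    -- to `k + 1`, the source of `C(n+1, k+1)`.
    rw [sub_eq_neg_add, (Commute.one_right (-L)).add_pow, Finset.sum_range_succ', add_comm,
      sub_eq_add_neg, ← Finset.sum_neg_distrib]
    congr 1
    · simp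
    · refine Finset.sum_congr rfl fun k _ ↦ ?_
      have hneg : (-L) ^ (k + 1) = (-1 : ℂ) ^ (k + 1) • L ^ (k + 1) := by
        rw [← neg_one_smul ℂ L, smul_pow]
      rw [one_pow, mul_one, hneg, ← (Nat.cast_commute _ _).eq, ← nsmul_eq_mul,
        ← Nat.cast_smul_eq_nsmul ℂ, smul_smul, ← neg_smul]
      congr 1
      ring
  rw [h, approxInv]
  simp only [LinearMap.sub_apply, Module.End.one_apply, LinearMap.sum_apply, LinearMap.smul_apply,
    sub_sub_cancel]
  refine Finset.sum_congr rfl fun k _ ↦ ?_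
  rw [pow_succ, Module.End.mul_apply, Module.End.pow_apply]

/-- The version of `approxInv_linear_apply` for a map of an ambient space that is linear on an
invariant subspace. -/
theorem approxInv_eq_sub_iterate {M : Type*} [AddCommGroup M] [Module ℂ M] (V : Submodule ℂ M)
    (T : M → M) (hT : ∀ v ∈ V, T v ∈ V) (hadd : ∀ v ∈ V, ∀ w ∈ V, T (v + w) = T v + T w)
    (hsmul : ∀ (c : ℂ), ∀ v ∈ V, T (c • v) = c • T v) (n : ℕ) {v : M} (hv : v ∈ V) :
    approxInv T n (T v) = v - (fun w ↦ w - T w)^[n + 1] v := by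
  -- On `V` the map becomes a genuine endomorphism, and the inclusion of `V` intertwines all
  -- iterates.
  let L : Module.End ℂ V :=
    { toFun := fun v ↦ ⟨T v, hT v v.2⟩
      map_add' := fun v w ↦ Subtype.ext (hadd v v.2 w w.2)
      map_smul' := fun c v ↦ Subtype.ext (hsmul c v v.2) }
  have hL : ∀ k (w : V), T^[k] (w : M) = ((L^[k] w : V) : M) := fun k w ↦
    (Function.Semiconj.iterate_right (f := ((↑) : V → M)) (ga := L) (gb := T)
      (fun _ ↦ rfl) k w).symm
  have hR : ∀ k (w : V), (fun w ↦ w - T w)^[k] (w : M) = (((1 - L) ^ k) w : V) := fun k w ↦ by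
    rw [Module.End.pow_apply]
    exact (Function.Semiconj.iterate_right (f := ((↑) : V → M)) (ga := (1 - L : Module.End ℂ V))
      (gb := fun w ↦ w - T w) (fun _ ↦ rfl) k w).symm
  have key := congrArg ((↑) : V → M) (approxInv_linear_apply L n ⟨v, hv⟩)
  rw [Submodule.coe_sub, ← hR] at key
  rw [← key, approxInv, approxInv, Submodule.coe_sum]
  refine Finset.sum_congr rfl fun k _ ↦ ?_
  rw [Submodule.coe_smul, ← hL]
  rfl

/-! ### Residuals on the Schwartz space -/

/-- The operator `ψ ↦ ψ - g * ψ` on the Schwartz space. -/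
def residual (g : 𝓢(ℝ, ℂ)) : 𝓢(ℝ, ℂ) →L[ℂ] 𝓢(ℝ, ℂ) :=
  1 - SchwartzMap.convolution (ContinuousLinearMap.mul ℂ ℂ) g

theorem fourier_convolution_mul_apply (g ψ : 𝓢(ℝ, ℂ)) (ξ : ℝ) :
    𝓕 (SchwartzMap.convolution (ContinuousLinearMap.mul ℂ ℂ) g ψ) ξ = 𝓕 g ξ * 𝓕 ψ ξ := by
  rw [SchwartzMap.fourier_convolution]
  simp

/-- Convolution is commutative because its Fourier transform is a pointwise product. This turns
`convSchwartz g` into a continuous linear map. -/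
theorem convSchwartz_eq_convolution (g : 𝓢(ℝ, ℂ)) :
    convSchwartz g = SchwartzMap.convolution (ContinuousLinearMap.mul ℂ ℂ) g := by
  ext1 ψ
  refine (FourierTransform.fourierEquiv ℂ 𝓢(ℝ, ℂ)).injective (SchwartzMap.ext fun ξ ↦ ?_)
  change 𝓕 (SchwartzMap.convolution (ContinuousLinearMap.mul ℂ ℂ) ψ g) ξ =
    𝓕 (SchwartzMap.convolution (ContinuousLinearMap.mul ℂ ℂ) g ψ) ξ
  rw [fourier_convolution_mul_apply, fourier_convolution_mul_apply, mul_comm]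

theorem fourier_residual_apply (g ψ : 𝓢(ℝ, ℂ)) (ξ : ℝ) :
    𝓕 (residual g ψ) ξ = (1 - 𝓕 g ξ) * 𝓕 ψ ξ := by
  have h : residual g ψ = ψ - SchwartzMap.convolution (ContinuousLinearMap.mul ℂ ℂ) g ψ := rfl
  rw [h, sub_eq_add_neg, ← neg_one_smul ℂ, FourierTransform.fourier_add,
    FourierTransform.fourier_smul, add_apply, smul_apply, fourier_convolution_mul_apply]
  rw [neg_one_smul]
  ring

theorem fourier_residual_pow_apply (g ψ : 𝓢(ℝ, ℂ)) (n : ℕ) (ξ : ℝ) :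
    𝓕 ((residual g ^ n) ψ) ξ = (1 - 𝓕 g ξ) ^ n * 𝓕 ψ ξ := by
  induction n with
  | zero => simp
  | succ n ih =>
    rw [pow_succ', mul_apply_eq_comp, fourier_residual_apply, ih]
    ring

/-- Test functions are convolved with the reflected kernel; this carries the spectral hypothesis
over to it. -/
theorem fourier_reflect_apply (g : 𝓢(ℝ, ℂ)) (ξ : ℝ) : 𝓕 (reflect g) ξ = 𝓕 g (-ξ) := by
  rw [SchwartzMap.fourier_coe, SchwartzMap.fourier_coe, ← Real.fourierInv_eq_fourier_neg,
    Real.fourierInv_eq_fourier_comp_neg]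
  congr 1

theorem approxInv_convSchwartz (g ψ : 𝓢(ℝ, ℂ)) (n : ℕ) :
    approxInv (convSchwartz g) n (convSchwartz g ψ) = ψ - (residual g ^ (n + 1)) ψ := by
  have := approxInv_linear_apply
    (SchwartzMap.convolution (ContinuousLinearMap.mul ℂ ℂ) g).toLinearMap n ψ
  rw [convSchwartz_eq_convolution]
  refine this.trans ?_
  congr 1
  rw [Module.End.pow_apply, ← ContinuousLinearMap.coe_coe, ContinuousLinearMap.toLinearMap_pow,
    Module.End.pow_apply]
  rfl

theorem approxInv_convTempered_apply (g : 𝓢(ℝ, ℂ)) (u : 𝓢'(ℝ, ℂ)) (n : ℕ) (ψ : 𝓢(ℝ, ℂ)) :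
    approxInv (convTempered g) n (convTempered g u) ψ =
      u ψ - u ((residual (reflect g) ^ (n + 1)) ψ) := by
  have h := approxInv_linear_apply (convTempered g).toLinearMap n u
  have h1 : ∀ k (v : 𝓢'(ℝ, ℂ)),
      ((1 - (convTempered g).toLinearMap) ^ k : Module.End ℂ 𝓢'(ℝ, ℂ)) v ψ =
        v ((residual (reflect g) ^ k) ψ) := by
    intro k
    induction k with
    | zero => intro v; rfl
    | succ k ih =>
      intro v
      rw [pow_succ, Module.End.mul_apply, ih, pow_succ', mul_apply_eq_comp]
      exact (map_sub v _ _).symm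
  rw [← h1 (n + 1) u]
  exact congrArg (fun v : 𝓢'(ℝ, ℂ) ↦ v ψ) h

/-- Weak-* convergence is tested on each `ψ`, where by transposition the error is `u` applied to a
residual power of `ψ`. -/
theorem tendsto_approxInv_convTempered_iff (g : 𝓢(ℝ, ℂ)) (u : 𝓢'(ℝ, ℂ)) :
    Tendsto (fun n ↦ approxInv (convTempered g) n (convTempered g u)) atTop (𝓝 u) ↔
      ∀ ψ, Tendsto (fun n ↦ u ((residual (reflect g) ^ n) ψ)) atTop (𝓝 0) := by
  rw [PointwiseConvergenceCLM.tendsto_iff_forall_tendsto]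
  refine forall_congr' fun ψ ↦ ?_
  rw [← tendsto_add_atTop_iff_nat (f := fun n ↦ u ((residual (reflect g) ^ n) ψ)) 1]
  simp only [approxInv_convTempered_apply]
  constructor <;> intro h
  · simpa only [sub_sub_cancel, sub_self] using h.const_sub (u ψ)
  · simpa only [sub_zero] using h.const_sub (u ψ)

/-! ### Decay of residual powers -/

/-- Powers of a function of modulus less than one kill any integrable function in `L¹`. -/
theorem tendsto_integral_norm_pow_mul {H w : ℝ → ℂ} (hH : Integrable H) (hw : Continuous w)
    (hw1 : ∀ ξ, ‖w ξ‖ < 1) :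
    Tendsto (fun n : ℕ ↦ ∫ ξ, ‖w ξ ^ n * H ξ‖) atTop (𝓝 0) := by
  have := tendsto_integral_of_dominated_convergence (F := fun (n : ℕ) ξ ↦ ‖w ξ ^ n * H ξ‖)
    (f := fun _ ↦ 0) (fun ξ ↦ ‖H ξ‖) (μ := volume)
    (fun n ↦ ((hw.pow n).aestronglyMeasurable.mul hH.1).norm) hH.norm
    (fun n ↦ ae_of_all _ fun ξ ↦ by
      rw [norm_norm, norm_mul, norm_pow]
      exact mul_le_of_le_one_left (norm_nonneg _) (pow_le_one₀ (norm_nonneg _) (hw1 ξ).le))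
    (ae_of_all _ fun ξ ↦ by
      have := (tendsto_pow_atTop_nhds_zero_of_norm_lt_one (hw1 ξ)).mul_const (H ξ)
      simpa using this.norm)
  simpa using this

theorem norm_apply_le_integral_norm_fourier (ψ : 𝓢(ℝ, ℂ)) (x : ℝ) :
    ‖ψ x‖ ≤ ∫ ξ, ‖𝓕 ψ ξ‖ := by
  have h : ψ x = 𝓕⁻ (𝓕 ψ) x := by rw [FourierTransform.fourierInv_fourier_eq]
  rw [h, SchwartzMap.fourierInv_coe]
  exact VectorFourier.norm_fourierIntegral_le_integral_norm _ _ _ _ _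

theorem exists_tendsto_norm_residual_pow_le {g : 𝓢(ℝ, ℂ)} (hg : ∀ ξ, ‖1 - 𝓕 g ξ‖ < 1)
    (ψ : 𝓢(ℝ, ℂ)) :
    ∃ b : ℕ → ℝ, Tendsto b atTop (𝓝 0) ∧ ∀ n x, ‖(residual g ^ n) ψ x‖ ≤ b n := by
  refine ⟨_, tendsto_integral_norm_pow_mul (w := fun ξ ↦ 1 - 𝓕 g ξ)
    (𝓕 ψ).integrable (continuous_const.sub (𝓕 g).continuous) hg, fun n x ↦ ?_⟩
  refine (norm_apply_le_integral_norm_fourier _ x).trans_eq ?_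
  simp only [fourier_residual_pow_apply]

end Deconvolution
end

/-! ### Plancherel decay, commutation relations and the principal value -/

noncomputable section

namespace Deconvolution

theorem tendsto_integral_norm_sq_residual_pow {g : 𝓢(ℝ, ℂ)} (hg : ∀ ξ, ‖1 - 𝓕 g ξ‖ < 1)
    (ψ : 𝓢(ℝ, ℂ)) :
    Tendsto (fun n ↦ ∫ x, ‖(residual g ^ n) ψ x‖ ^ 2) atTop (𝓝 0) := by
  -- Squaring both multiplier and transform makes the `L¹` statement a statement about `L²` norms.
  have h := tendsto_integral_norm_pow_mul (w := fun ξ ↦ (1 - 𝓕 g ξ) ^ 2)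
    (SchwartzMap.pairing (ContinuousLinearMap.mul ℂ ℂ) (𝓕 ψ) (𝓕 ψ)).integrable
    ((continuous_const.sub (𝓕 g).continuous).pow 2) fun ξ ↦ by
      rw [norm_pow]
      exact pow_lt_one₀ (norm_nonneg _) (hg ξ) two_ne_zero
  refine h.congr fun n ↦ ?_
  rw [← SchwartzMap.integral_norm_sq_fourier]
  refine integral_congr_ae (ae_of_all _ fun ξ ↦ ?_)
  simp only [fourier_residual_pow_apply, SchwartzMap.pairing_apply_apply,
    ContinuousLinearMap.mul_apply', norm_mul, norm_pow]
  ring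

/-- Both operators are Fourier multipliers. Hence derivatives of residual powers decay uniformly as
well, as the principal value requires. -/
theorem commute_derivCLM_residual (g : 𝓢(ℝ, ℂ)) :
    Commute (SchwartzMap.derivCLM ℂ ℂ) (residual g) := by
  ext1 ψ
  refine (FourierTransform.fourierEquiv ℂ 𝓢(ℝ, ℂ)).injective (SchwartzMap.ext fun ξ ↦ ?_)
  have hd : ∀ h : 𝓢(ℝ, ℂ), 𝓕 (SchwartzMap.derivCLM ℂ ℂ h) ξ =
      (2 * Real.pi * Complex.I * ξ) • 𝓕 h ξ := fun h ↦ by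
    rw [SchwartzMap.fourier_coe, SchwartzMap.fourier_coe]
    exact congrFun (Real.fourier_deriv h.integrable h.differentiable
      (SchwartzMap.derivCLM ℂ ℂ h).integrable) ξ
  change 𝓕 (SchwartzMap.derivCLM ℂ ℂ (residual g ψ)) ξ =
    𝓕 (residual g (SchwartzMap.derivCLM ℂ ℂ ψ)) ξ
  rw [hd, fourier_residual_apply, fourier_residual_apply, hd]
  simp only [smul_eq_mul]
  ring

theorem commute_compSubConstCLM_residual (a : ℝ) (g : 𝓢(ℝ, ℂ)) :
    Commute (SchwartzMap.compSubConstCLM ℂ a) (residual g) := by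
  refine Commute.sub_right (Commute.one_right _) (ContinuousLinearMap.ext fun ψ ↦
    SchwartzMap.ext fun x ↦ ?_)
  simp only [mul_apply_eq_comp, SchwartzMap.compSubConstCLM_apply]
  rw [← convSchwartz_eq_convolution, coe_convSchwartz, coe_convSchwartz, convFun_apply,
    convFun_apply]
  simp only [SchwartzMap.compSubConstCLM_apply, sub_right_comm]

/-- The principal value is controlled by the supremum of the derivative and the `L²` norm. -/
theorem norm_pvDist_le (ψ : 𝓢(ℝ, ℂ)) {D : ℝ} (hD : ∀ x, ‖deriv ψ x‖ ≤ D) :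
    ‖pvDist ψ‖ ≤ 2 * D + 2 * √(∫ x, ‖ψ x‖ ^ 2) := by
  -- Cauchy–Schwarz on `(1, ∞)`, where `1/x` has `L²` norm one.
  have hsq : ∀ h : 𝓢(ℝ, ℂ), ∫ x in Set.Ioi (1 : ℝ), ‖h x‖ * ‖x⁻¹‖ ≤ √(∫ x, ‖h x‖ ^ 2) := by
    intro h
    have hinv : MemLp (fun x : ℝ ↦ x⁻¹) (ENNReal.ofReal 2) (volume.restrict (Set.Ioi 1)) := by
      rw [ENNReal.ofReal_ofNat, memLp_two_iff_integrable_sq measurable_inv.aestronglyMeasurable]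
      refine (integrableOn_Ioi_rpow_of_lt (a := -2) (by norm_num) one_pos).congr_fun
        (fun x hx ↦ ?_) measurableSet_Ioi
      have hx0 : (0 : ℝ) < x := one_pos.trans hx
      simp only [Real.rpow_neg hx0.le, Real.rpow_ofNat, inv_pow]
    have hint : ∫ x in Set.Ioi (1 : ℝ), ‖x⁻¹‖ ^ (2 : ℝ) = 1 := by
      have h1 := integral_Ioi_rpow_of_lt (a := -2) (by norm_num) one_pos
      have h2 : ∫ x in Set.Ioi (1 : ℝ), ‖x⁻¹‖ ^ (2 : ℝ) = ∫ x in Set.Ioi (1 : ℝ), x ^ (-2 : ℝ) := by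
        refine setIntegral_congr_fun measurableSet_Ioi fun x hx ↦ ?_
        have hx0 : (0 : ℝ) < x := one_pos.trans hx
        simp only [Real.rpow_neg hx0.le, Real.rpow_ofNat, norm_inv, Real.norm_eq_abs, inv_pow,
          sq_abs]
      rw [h2, h1]
      norm_num
    have hh : MemLp h (ENNReal.ofReal 2) (volume.restrict (Set.Ioi 1)) :=
      (h.memLp _ volume).restrict _
    have := integral_mul_norm_le_Lp_mul_Lq Real.HolderConjugate.two_two hh.norm hinv
    simp only [norm_norm] at this
    rw [hint, Real.one_rpow, mul_one, ← Real.sqrt_eq_rpow] at this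
    refine this.trans (Real.sqrt_le_sqrt ?_)
    simp only [Real.rpow_ofNat]
    refine setIntegral_le_integral ?_ (ae_of_all _ fun x ↦ by positivity)
    exact (memLp_two_iff_integrable_sq_norm h.continuous.aestronglyMeasurable).1 (h.memLp 2 volume)
  have hint := integrableOn_pvIntegrand ψ
  have hint0 := hint.mono_set (Set.Ioc_subset_Ioi_self : Set.Ioc (0 : ℝ) 1 ⊆ _)
  have hint1 := hint.mono_set (Set.Ioi_subset_Ioi (zero_le_one (α := ℝ)))
  rw [pvDist_apply, ← Set.Ioc_union_Ioi_eq_Ioi (zero_le_one (α := ℝ)),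
    setIntegral_union (Set.Ioc_disjoint_Ioi le_rfl) measurableSet_Ioi hint0 hint1]
  refine (norm_add_le _ _).trans (add_le_add ?_ ?_)
  -- Near zero the mean value inequality on `[-x, x]` yields `2Dx`, which cancels the singularity.
  · have := norm_setIntegral_le_of_norm_le_const (μ := volume) (s := Set.Ioc (0 : ℝ) 1)
      (f := fun x : ℝ ↦ (ψ x - ψ (-x)) / (x : ℂ)) (C := 2 * D) (by simp) fun x hx ↦ by
        have := Convex.norm_image_sub_le_of_norm_deriv_le (f := ψ) (s := Set.univ) (x := -x)
          (y := x) (C := D) (fun z _ ↦ ψ.differentiableAt) (fun z _ ↦ hD z)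
          convex_univ (Set.mem_univ _) (Set.mem_univ _)
        rw [norm_div, Complex.norm_real, Real.norm_eq_abs, abs_of_pos hx.1, div_le_iff₀ hx.1]
        refine this.trans_eq ?_
        rw [Real.norm_eq_abs, abs_of_pos (by linarith [hx.1])]
        ring
    simpa using this
  · have hbd : ∀ h : 𝓢(ℝ, ℂ), IntegrableOn (fun x : ℝ ↦ ‖h x‖ * ‖x⁻¹‖) (Set.Ioi 1) := by
      intro h
      refine Integrable.mono' (h.integrable.norm.integrableOn (s := Set.Ioi 1))
        (h.continuous.norm.measurable.mul measurable_inv.norm).aestronglyMeasurable ?_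
      filter_upwards [ae_restrict_mem measurableSet_Ioi] with x hx
      rw [norm_mul, norm_norm, norm_norm, norm_inv]
      refine mul_le_of_le_one_right (norm_nonneg _) (inv_le_one_of_one_le₀ ?_)
      exact (le_of_lt hx).trans (le_abs_self x)
    have hrefl : √(∫ x, ‖reflect ψ x‖ ^ 2) = √(∫ x, ‖ψ x‖ ^ 2) := by
      simp only [reflect_apply]
      rw [integral_neg_eq_self (fun x ↦ ‖ψ x‖ ^ 2)]
    calc _ ≤ ∫ x in Set.Ioi (1 : ℝ), (‖ψ x‖ * ‖x⁻¹‖ + ‖reflect ψ x‖ * ‖x⁻¹‖) := by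
          refine norm_integral_le_of_norm_le ((hbd ψ).add (hbd _)) (ae_of_all _ fun x ↦ ?_)
          rw [norm_div, div_eq_mul_inv, Complex.norm_real, norm_inv, ← add_mul, reflect_apply]
          gcongr
          exact norm_sub_le _ _
      _ = _ := integral_add (hbd ψ) (hbd _)
      _ ≤ _ := add_le_add (hsq ψ) (hsq _)
      _ = _ := by rw [hrefl]; ring

/-! ### Convergence for the basic distributions -/

theorem tendsto_basicDists_residual_pow {g : 𝓢(ℝ, ℂ)} (hg : ∀ ξ, ‖1 - 𝓕 g ξ‖ < 1)
    {u : 𝓢'(ℝ, ℂ)} (hu : u ∈ basicDists) (ψ : 𝓢(ℝ, ℂ)) :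
    Tendsto (fun n ↦ u ((residual g ^ n) ψ)) atTop (𝓝 0) := by
  have hF : ∀ ξ, Tendsto (fun n ↦ 𝓕 ((residual g ^ n) ψ) ξ) atTop (𝓝 0) := fun ξ ↦ by
    simp only [fourier_residual_pow_apply]
    simpa using (tendsto_pow_atTop_nhds_zero_of_norm_lt_one (hg ξ)).mul_const (𝓕 ψ ξ)
  rcases hu with (rfl | rfl | rfl) | ⟨y, rfl⟩
  -- Pairing with `1` evaluates the Fourier transform at zero; below, the character of frequency `y`
  -- evaluates it at `-y`.
  · refine (hF 0).congr fun n ↦ ?_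
    rw [oneDist_apply, SchwartzMap.fourier_coe, Real.fourier_real_eq_integral_exp_smul]
    simp
  · obtain ⟨b, hb, hle⟩ := exists_tendsto_norm_residual_pow_le hg ψ
    exact squeeze_zero_norm (fun n ↦ hle n 0) hb
  · obtain ⟨b, hb, hle⟩ := exists_tendsto_norm_residual_pow_le hg (SchwartzMap.derivCLM ℂ ℂ ψ)
    refine squeeze_zero_norm (a := fun n ↦ 2 * b n + 2 * √(∫ x, ‖(residual g ^ n) ψ x‖ ^ 2))
      (fun n ↦ norm_pvDist_le _ fun x ↦ ?_) ?_
    · have h : SchwartzMap.derivCLM ℂ ℂ ((residual g ^ n) ψ) =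
          (residual g ^ n) (SchwartzMap.derivCLM ℂ ℂ ψ) :=
        congrArg (fun A : 𝓢(ℝ, ℂ) →L[ℂ] 𝓢(ℝ, ℂ) ↦ A ψ)
          ((commute_derivCLM_residual g).pow_right n).eq
      rw [← SchwartzMap.derivCLM_apply ℂ, h]
      exact hle n x
    · simpa using (hb.const_mul 2).add
        ((tendsto_integral_norm_sq_residual_pow hg ψ).sqrt.const_mul 2)
  · refine (hF (-y)).congr fun n ↦ ?_
    rw [characterDist_apply, SchwartzMap.fourier_coe, Real.fourier_real_eq_integral_exp_smul]
    refine integral_congr_ae (ae_of_all _ fun x ↦ ?_)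
    simp only [smul_eq_mul]
    rw [mul_comm]
    congr 2
    push_cast
    ring

/-- Translations pass to the test function and commute with the residual; the decay is linear in
`u`. -/
theorem tendsto_span_translates_residual_pow {g : 𝓢(ℝ, ℂ)} (hg : ∀ ξ, ‖1 - 𝓕 g ξ‖ < 1)
    {u : 𝓢'(ℝ, ℂ)} (hu : u ∈ Submodule.span ℂ
      {v : 𝓢'(ℝ, ℂ) | ∃ a : ℝ, ∃ w ∈ basicDists, v = translateDist a w}) (ψ : 𝓢(ℝ, ℂ)) :
    Tendsto (fun n ↦ u ((residual g ^ n) ψ)) atTop (𝓝 0) := by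
  induction hu using Submodule.span_induction with
  | mem v hv =>
    obtain ⟨a, w, hw, rfl⟩ := hv
    refine (tendsto_basicDists_residual_pow hg hw (SchwartzMap.compSubConstCLM ℂ (-a) ψ)).congr
      fun n ↦ ?_
    rw [translateDist_apply]
    exact congrArg (fun A : 𝓢(ℝ, ℂ) →L[ℂ] 𝓢(ℝ, ℂ) ↦ w (A ψ))
      ((commute_compSubConstCLM_residual (-a) g).pow_right n).eq.symm
  | zero => exact tendsto_const_nhds
  | add v w _ _ hv hw =>
    have := hv.add hw
    rw [add_zero] at this
    exact this
  | smul c v _ hv =>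
    have := hv.const_smul c
    rw [smul_zero] at this
    exact this

end Deconvolution
end

noncomputable section

namespace Deconvolution

/-! ### Convolution of square-integrable functions with a Schwartz kernel -/

theorem memLp_two_comp_sub_left (g : 𝓢(ℝ, ℂ)) (x : ℝ) : MemLp (fun t ↦ g (x - t)) 2 volume :=
  (g.memLp 2 volume).comp_measurePreserving (Measure.measurePreserving_sub_left volume x)

theorem convolutionExists_of_memLp_two (g : 𝓢(ℝ, ℂ)) {f : ℝ → ℂ} (hf : MemLp f 2 volume) :
    ConvolutionExists f (g : ℝ → ℂ) (ContinuousLinearMap.mul ℂ ℂ) volume :=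
  fun x ↦ hf.integrable_mul (memLp_two_comp_sub_left g x)

/-- Cauchy–Schwarz, uniformly in `x`: `L²` approximation of `f` gives pointwise convergence of the
convolutions. -/
theorem enorm_convFun_le (g : 𝓢(ℝ, ℂ)) {f : ℝ → ℂ} (hf : MemLp f 2 volume) (x : ℝ) :
    ‖convFun g f x‖ₑ ≤ eLpNorm f 2 volume * eLpNorm g 2 volume := by
  have h1 : convFun g f x = ∫ t, (f • fun t ↦ g (x - t)) t := by
    simp [convFun, convolution_def]
  have h2 : eLpNorm (fun t ↦ g (x - t)) 2 volume = eLpNorm g 2 volume :=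
    eLpNorm_comp_measurePreserving g.continuous.aestronglyMeasurable
      (Measure.measurePreserving_sub_left volume x)
  rw [h1, ← h2]
  refine (enorm_integral_le_lintegral_enorm _).trans ?_
  rw [← eLpNorm_one_eq_lintegral_enorm]
  exact eLpNorm_smul_le_mul_eLpNorm (memLp_two_comp_sub_left g x).1 hf.1

theorem convFun_add {g : 𝓢(ℝ, ℂ)} {f h : ℝ → ℂ}
    (hf : ConvolutionExists f (g : ℝ → ℂ) (ContinuousLinearMap.mul ℂ ℂ) volume)
    (hh : ConvolutionExists h (g : ℝ → ℂ) (ContinuousLinearMap.mul ℂ ℂ) volume) :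
    convFun g (f + h) = convFun g f + convFun g h :=
  hf.add_distrib hh

theorem convFun_smul (g : 𝓢(ℝ, ℂ)) (c : ℂ) (f : ℝ → ℂ) :
    convFun g (c • f) = c • convFun g f :=
  smul_convolution

theorem convFun_sub {g : 𝓢(ℝ, ℂ)} {f h : ℝ → ℂ}
    (hf : ConvolutionExists f (g : ℝ → ℂ) (ContinuousLinearMap.mul ℂ ℂ) volume)
    (hh : ConvolutionExists h (g : ℝ → ℂ) (ContinuousLinearMap.mul ℂ ℂ) volume) :
    convFun g (f - h) = convFun g f - convFun g h := by
  have := convFun_add hf (f := f) (h := (-1 : ℂ) • h) (g := g) fun x ↦ by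
    simpa [ConvolutionExistsAt] using (hh x).neg
  rw [convFun_smul, neg_one_smul, neg_one_smul, ← sub_eq_add_neg, ← sub_eq_add_neg] at this
  exact this

/-- The operator `f ↦ f - f * g` on functions. -/
def residualFun (g : 𝓢(ℝ, ℂ)) (f : ℝ → ℂ) : ℝ → ℂ := f - convFun g f

theorem residualFun_coe (g ψ : 𝓢(ℝ, ℂ)) : residualFun g ψ = residual g ψ := by
  have h : residual g ψ = ψ - convSchwartz g ψ := by rw [convSchwartz_eq_convolution]; rfl
  rw [h, residualFun, ← coe_convSchwartz]
  rfl

theorem residualFun_iterate_coe (g ψ : 𝓢(ℝ, ℂ)) (n : ℕ) :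
    (residualFun g)^[n] ψ = (residual g ^ n) ψ := by
  induction n with
  | zero => rfl
  | succ n ih => rw [Function.iterate_succ_apply', ih, residualFun_coe, pow_succ']; rfl

theorem eLpNorm_two_eq (ψ : 𝓢(ℝ, ℂ)) :
    eLpNorm ψ 2 volume = ENNReal.ofReal √(∫ x, ‖ψ x‖ ^ 2) := by
  rw [(ψ.memLp 2 volume).eLpNorm_eq_integral_rpow_norm two_ne_zero ENNReal.ofNat_ne_top,
    Real.sqrt_eq_rpow]
  simp

theorem eLpNorm_residual_le {g : 𝓢(ℝ, ℂ)} (hg : ∀ ξ, ‖1 - 𝓕 g ξ‖ < 1) (ψ : 𝓢(ℝ, ℂ)) :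
    eLpNorm (residual g ψ) 2 volume ≤ eLpNorm ψ 2 volume := by
  rw [eLpNorm_two_eq, eLpNorm_two_eq, ← SchwartzMap.integral_norm_sq_fourier,
    ← SchwartzMap.integral_norm_sq_fourier ψ]
  refine ENNReal.ofReal_le_ofReal (Real.sqrt_le_sqrt ?_)
  have hint : ∀ h : 𝓢(ℝ, ℂ), Integrable fun x ↦ ‖h x‖ ^ 2 := fun h ↦
    (memLp_two_iff_integrable_sq_norm h.continuous.aestronglyMeasurable).1 (h.memLp 2 volume)
  refine integral_mono (hint _) (hint _) fun ξ ↦ ?_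
  simp only [fourier_residual_apply, norm_mul]
  gcongr
  exact mul_le_of_le_one_left (norm_nonneg _) (hg ξ).le

theorem exists_schwartz_eLpNorm_sub_le {f : ℝ → ℂ} (hf : MemLp f 2 volume) {δ : ℝ} (hδ : 0 < δ) :
    ∃ ψ : 𝓢(ℝ, ℂ), eLpNorm (f - ⇑ψ) 2 volume ≤ ENNReal.ofReal δ := by
  obtain ⟨h, h1, h2, h3⟩ := MemLp.exist_eLpNorm_sub_le ENNReal.ofNat_ne_top one_le_two hf hδ
  exact ⟨h1.toSchwartzMap h2, h3⟩

/-- The residual operator is a contraction of `L²`. -/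
theorem memLp_residualFun {g : 𝓢(ℝ, ℂ)} (hg : ∀ ξ, ‖1 - 𝓕 g ξ‖ < 1) {f : ℝ → ℂ}
    (hf : MemLp f 2 volume) :
    MemLp (residualFun g f) 2 volume ∧
      eLpNorm (residualFun g f) 2 volume ≤ eLpNorm f 2 volume := by
  choose ψ hψ using fun k : ℕ ↦ exists_schwartz_eLpNorm_sub_le hf (Nat.one_div_pos_of_nat (n := k))
  have hlim : Tendsto (fun k ↦ eLpNorm (f - ⇑(ψ k)) 2 volume) atTop (𝓝 0) := by
    refine tendsto_of_tendsto_of_tendsto_of_le_of_le tendsto_const_nhds ?_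
      (fun _ ↦ zero_le) hψ
    simpa using ENNReal.tendsto_ofReal (tendsto_one_div_add_atTop_nhds_zero_nat (𝕜 := ℝ))
  have hlim' : Tendsto (fun k ↦ eLpNorm (⇑(ψ k) - f) 2 volume) atTop (𝓝 0) := by
    simpa only [eLpNorm_sub_comm] using hlim
  have hsub : ∀ k, MemLp (f - ⇑(ψ k)) 2 volume := fun k ↦ hf.sub ((ψ k).memLp 2 volume)
  have hconv : ∀ x, Tendsto (fun k ↦ convFun g (ψ k) x) atTop (𝓝 (convFun g f x)) := by
    intro x
    rw [tendsto_iff_edist_tendsto_0]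
    refine tendsto_of_tendsto_of_tendsto_of_le_of_le tendsto_const_nhds
      (h := fun k ↦ eLpNorm (f - ⇑(ψ k)) 2 volume * eLpNorm g 2 volume) ?_ (fun _ ↦ zero_le)
      fun k ↦ ?_
    · simpa using ENNReal.Tendsto.mul_const hlim (Or.inr (g.memLp 2 volume).2.ne)
    · have h := enorm_convFun_le g (hsub k) x
      rwa [convFun_sub (convolutionExists_of_memLp_two g hf)
        (convolutionExists_of_memLp_two g ((ψ k).memLp 2 volume)), Pi.sub_apply,
        ← edist_eq_enorm_sub, edist_comm] at h
  -- A subsequence of the Schwartz approximants converges almost everywhere, hence so do their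
  -- residuals; Fatou then transfers the contraction bound to `f` without a Fourier transform on
  -- `L²`.
  obtain ⟨ns, hns, hae⟩ := (tendstoInMeasure_of_tendsto_eLpNorm two_ne_zero
    (fun k ↦ (ψ k).continuous.aestronglyMeasurable) hf.1 hlim').exists_seq_tendsto_ae
  have hres : ∀ᵐ x, Tendsto (fun k ↦ residual g (ψ (ns k)) x) atTop (𝓝 (residualFun g f x)) := by
    filter_upwards [hae] with x hx
    simp only [← residualFun_coe]
    exact hx.sub ((hconv x).comp hns.tendsto_atTop)
  have hle : eLpNorm (residualFun g f) 2 volume ≤ eLpNorm f 2 volume := by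
    refine (Lp.eLpNorm_lim_le_liminf_eLpNorm
      (fun k ↦ (residual g (ψ (ns k))).continuous.aestronglyMeasurable) _ hres).trans ?_
    have hlim2 : Tendsto (fun k ↦ eLpNorm f 2 volume + eLpNorm (⇑(ψ (ns k)) - f) 2 volume) atTop
        (𝓝 (eLpNorm f 2 volume)) := by
      simpa using (hlim'.comp hns.tendsto_atTop).const_add (eLpNorm f 2 volume)
    rw [← hlim2.liminf_eq]
    refine liminf_le_liminf (Eventually.of_forall fun k ↦ (eLpNorm_residual_le hg _).trans ?_)
    have := eLpNorm_add_le hf.1 (((ψ (ns k)).memLp 2 volume).sub hf).1 one_le_two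
    rwa [add_sub_cancel] at this
  exact ⟨⟨aestronglyMeasurable_of_tendsto_ae atTop
    (fun k ↦ (residual g (ψ (ns k))).continuous.aestronglyMeasurable) hres,
    hle.trans_lt hf.2⟩, hle⟩

theorem memLp_residualFun_iterate {g : 𝓢(ℝ, ℂ)} (hg : ∀ ξ, ‖1 - 𝓕 g ξ‖ < 1) {f : ℝ → ℂ}
    (hf : MemLp f 2 volume) (n : ℕ) :
    MemLp ((residualFun g)^[n] f) 2 volume ∧
      eLpNorm ((residualFun g)^[n] f) 2 volume ≤ eLpNorm f 2 volume := by
  induction n with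
  | zero => exact ⟨hf, le_rfl⟩
  | succ n ih =>
    rw [Function.iterate_succ_apply']
    have := memLp_residualFun hg ih.1
    exact ⟨this.1, this.2.trans ih.2⟩

theorem memLp_convFun {g : 𝓢(ℝ, ℂ)} (hg : ∀ ξ, ‖1 - 𝓕 g ξ‖ < 1) {f : ℝ → ℂ}
    (hf : MemLp f 2 volume) : MemLp (convFun g f) 2 volume := by
  simpa [residualFun] using hf.sub (memLp_residualFun hg hf).1

theorem memLp_convFun_iterate {g : 𝓢(ℝ, ℂ)} (hg : ∀ ξ, ‖1 - 𝓕 g ξ‖ < 1) {f : ℝ → ℂ}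
    (hf : MemLp f 2 volume) (k : ℕ) : MemLp ((convFun g)^[k] f) 2 volume := by
  induction k with
  | zero => exact hf
  | succ k ih =>
    rw [Function.iterate_succ_apply']
    exact memLp_convFun hg ih

theorem residualFun_iterate_sub {g : 𝓢(ℝ, ℂ)} (hg : ∀ ξ, ‖1 - 𝓕 g ξ‖ < 1) {f h : ℝ → ℂ}
    (hf : MemLp f 2 volume) (hh : MemLp h 2 volume) (n : ℕ) :
    (residualFun g)^[n] (f - h) = (residualFun g)^[n] f - (residualFun g)^[n] h := by
  induction n with
  | zero => rfl
  | succ n ih =>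
    rw [Function.iterate_succ_apply', ih, Function.iterate_succ_apply',
      Function.iterate_succ_apply', residualFun, convFun_sub
      (convolutionExists_of_memLp_two g (memLp_residualFun_iterate hg hf n).1)
      (convolutionExists_of_memLp_two g (memLp_residualFun_iterate hg hh n).1), residualFun,
      residualFun]
    abel

/-- Density: the contraction keeps the part `f - ψ` small for all `n`, while the residual powers of
`ψ` decay. -/
theorem tendsto_eLpNorm_residualFun_iterate {g : 𝓢(ℝ, ℂ)} (hg : ∀ ξ, ‖1 - 𝓕 g ξ‖ < 1)
    {f : ℝ → ℂ} (hf : MemLp f 2 volume) :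
    Tendsto (fun n ↦ eLpNorm ((residualFun g)^[n] f) 2 volume) atTop (𝓝 0) := by
  rw [ENNReal.tendsto_nhds_zero]
  intro δ hδ
  obtain ⟨η, hη0, hη⟩ := ENNReal.lt_iff_exists_real_btwn.1 (ENNReal.half_pos hδ.ne')
  have hηpos : 0 < η := ENNReal.ofReal_pos.1 hη.1
  obtain ⟨ψ, hψ⟩ := exists_schwartz_eLpNorm_sub_le hf hηpos
  have hψm := ψ.memLp 2 volume
  have hlim : Tendsto (fun n ↦ eLpNorm ((residual g ^ n) ψ) 2 volume) atTop (𝓝 0) := by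
    simp only [eLpNorm_two_eq]
    simpa using ENNReal.tendsto_ofReal (tendsto_integral_norm_sq_residual_pow hg ψ).sqrt
  filter_upwards [ENNReal.tendsto_nhds_zero.1 hlim _ (ENNReal.half_pos hδ.ne')] with n hn
  have hsplit : (residualFun g)^[n] f = (residualFun g)^[n] (f - ⇑ψ) + (residual g ^ n) ψ := by
    rw [residualFun_iterate_sub hg hf hψm, residualFun_iterate_coe, sub_add_cancel]
  have hd := memLp_residualFun_iterate hg (hf.sub hψm) n
  rw [hsplit]
  refine (eLpNorm_add_le hd.1.1 (((residual g ^ n) ψ).memLp 2 volume).1 one_le_two).trans ?_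
  rw [← ENNReal.add_halves δ]
  exact add_le_add ((hd.2.trans hψ).trans hη.2.le) hn

theorem tendsto_eLpNorm_approxInv_sub {g : 𝓢(ℝ, ℂ)} (hg : ∀ ξ, ‖1 - 𝓕 g ξ‖ < 1)
    {f : ℝ → ℂ} (hf : MemLp f 2 volume) :
    Tendsto (fun n ↦ eLpNorm (approxInv (convFun g) n (convFun g f) - f) 2 volume) atTop
      (𝓝 0) := by
  -- Additivity of convolution needs the integrals to exist, so linearity is used only on this
  -- subspace.
  let V : Submodule ℂ (ℝ → ℂ) :=
    { carrier := {f | MemLp f 2 volume}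
      add_mem' := fun hf hg ↦ hf.add hg
      zero_mem' := MemLp.zero
      smul_mem' := fun c _ hf ↦ hf.const_smul c }
  refine ((tendsto_add_atTop_iff_nat 1).2 (tendsto_eLpNorm_residualFun_iterate hg hf)).congr
    fun n ↦ ?_
  rw [approxInv_eq_sub_iterate V (convFun g) (fun v hv ↦ memLp_convFun hg hv)
    (fun v hv w hw ↦ convFun_add (convolutionExists_of_memLp_two g hv)
      (convolutionExists_of_memLp_two g hw)) (fun c v _ ↦ convFun_smul g c v) n hf,
    sub_sub_cancel_left, eLpNorm_neg]
  rfl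

end Deconvolution
end

noncomputable section

namespace Deconvolution

/-! ### Fourier inversion almost everywhere -/

theorem integral_fourier_mul_eq {f h : ℝ → ℂ} (hf : Integrable f) (hh : Integrable h) :
    ∫ ξ, 𝓕 f ξ * h ξ = ∫ x, f x * 𝓕 h x := by
  simpa using! VectorFourier.integral_bilin_fourierIntegral_eq_flip (ContinuousLinearMap.mul ℂ ℂ)
    (L := innerₗ ℝ) Real.continuous_fourierChar continuous_inner hf hh

theorem continuous_fourierInv {H : ℝ → ℂ} (hH : Integrable H) : Continuous (𝓕⁻ H) := by
  rw [Real.fourierInv_eq_fourier_comp_neg]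
  exact VectorFourier.fourierIntegral_continuous Real.continuous_fourierChar continuous_inner
    hH.comp_neg

/-- An integrable function with integrable Fourier transform satisfies the inversion formula
almost everywhere. -/
theorem ae_eq_fourierInv_fourier {f : ℝ → ℂ} (hf : Integrable f) (hFf : Integrable (𝓕 f)) :
    f =ᵐ[volume] 𝓕⁻ (𝓕 f) := by
  refine ae_eq_of_integral_contDiff_smul_eq hf.locallyIntegrable
    (continuous_fourierInv hFf).locallyIntegrable fun χ hχ hχc ↦ ?_
  let ψ : 𝓢(ℝ, ℂ) := HasCompactSupport.toSchwartzMap (f := Complex.ofRealCLM ∘ χ)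
    (hχc.comp_left rfl) (by fun_prop)
  have hψ : ∀ x, (χ x : ℂ) = ψ x := fun x ↦ rfl
  -- By the multiplication formula, `f` and its candidate representative have the same integral
  -- against every test function.
  have h1 : ∫ x, ψ x * f x = ∫ ξ, 𝓕⁻ ψ ξ * 𝓕 f ξ := by
    have h := integral_fourier_mul_eq (𝓕⁻ ψ).integrable hf
    rwa [← SchwartzMap.fourier_coe, FourierTransform.fourier_fourierInv_eq] at h
  have h2 : ∫ x, ψ x * 𝓕⁻ (𝓕 f) x = ∫ ξ, 𝓕⁻ ψ ξ * 𝓕 f ξ := by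
    rw [Real.fourierInv_eq_fourier_comp_neg, ← integral_fourier_mul_eq ψ.integrable hFf.comp_neg,
      ← integral_neg_eq_self]
    simp only [neg_neg, SchwartzMap.fourierInv_coe, Real.fourierInv_eq_fourier_neg]
  simp only [Complex.real_smul, hψ]
  rw [h1, h2]

/-! ### Convolution of integrable functions with a Schwartz kernel -/

theorem convolutionExists_of_integrable (g : 𝓢(ℝ, ℂ)) {f : ℝ → ℂ} (hf : Integrable f) :
    ConvolutionExists f (g : ℝ → ℂ) (ContinuousLinearMap.mul ℂ ℂ) volume := fun x ↦
  hf.mul_bdd (c := SchwartzMap.seminorm ℝ 0 0 g)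
    (g.continuous.comp (continuous_sub_left x)).aestronglyMeasurable
    (ae_of_all _ fun t ↦ SchwartzMap.norm_le_seminorm ℝ g (x - t))

theorem integrable_convFun (g : 𝓢(ℝ, ℂ)) {f : ℝ → ℂ} (hf : Integrable f) :
    Integrable (convFun g f) :=
  hf.integrable_convolution (ContinuousLinearMap.mul ℂ ℂ) g.integrable

theorem integrable_convFun_iterate (g : 𝓢(ℝ, ℂ)) {f : ℝ → ℂ} (hf : Integrable f) (k : ℕ) :
    Integrable ((convFun g)^[k] f) := by
  induction k with
  | zero => exact hf
  | succ k ih =>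
    rw [Function.iterate_succ_apply']
    exact integrable_convFun g ih

theorem continuous_convFun (g : 𝓢(ℝ, ℂ)) {f : ℝ → ℂ} (hf : Integrable f) :
    Continuous (convFun g f) := by
  refine BddAbove.continuous_convolution_right_of_integrable _ ?_ hf g.continuous
  exact ⟨SchwartzMap.seminorm ℝ 0 0 g, fun x ⟨y, hy⟩ ↦ hy ▸ SchwartzMap.norm_le_seminorm ℝ g y⟩

/-- The equality holds at every point, so `f` may be replaced by its continuous representative
before pointwise limits are taken. -/
theorem convFun_congr_ae (g : 𝓢(ℝ, ℂ)) {f h : ℝ → ℂ} (hfh : f =ᵐ[volume] h) :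
    convFun g f = convFun g h := by
  ext x
  rw [convFun_apply, convFun_apply]
  refine integral_congr_ae ?_
  filter_upwards [(Measure.measurePreserving_sub_left volume x).quasiMeasurePreserving.ae_eq_comp
    hfh] with s hs
  simp only [Function.comp_apply] at hs
  rw [hs]

/-- Continuity is carried along so that Fourier inversion later holds at every point. -/
theorem residualFun_iterate_of_integrable (g : 𝓢(ℝ, ℂ)) {f : ℝ → ℂ} (hf : Integrable f)
    (hfc : Continuous f) (n : ℕ) :
    Integrable ((residualFun g)^[n] f) ∧ Continuous ((residualFun g)^[n] f) ∧
      ∀ ξ, 𝓕 ((residualFun g)^[n] f) ξ = (1 - 𝓕 g ξ) ^ n * 𝓕 f ξ := by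
  induction n with
  | zero => exact ⟨hf, hfc, fun ξ ↦ by simp⟩
  | succ n ih =>
    obtain ⟨h1, h2, h3⟩ := ih
    rw [Function.iterate_succ_apply']
    have hc := integrable_convFun g h1
    refine ⟨h1.sub hc, h2.sub (continuous_convFun g h1), fun ξ ↦ ?_⟩
    have hconv : 𝓕 (convFun g ((residualFun g)^[n] f)) ξ =
        𝓕 ((residualFun g)^[n] f) ξ * 𝓕 g ξ :=
      Real.fourier_mul_convolution_eq h1 g.integrable ξ
    have hsub : 𝓕 (residualFun g ((residualFun g)^[n] f)) ξ =
        𝓕 ((residualFun g)^[n] f) ξ - 𝓕 (convFun g ((residualFun g)^[n] f)) ξ := by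
      simp only [Real.fourier_eq, residualFun, Pi.sub_apply, smul_sub]
      exact integral_sub ((Real.fourierIntegral_convergent_iff ξ).2 h1)
        ((Real.fourierIntegral_convergent_iff ξ).2 hc)
    rw [hsub, hconv, h3]
    ring

theorem tendsto_residualFun_iterate_apply {g : 𝓢(ℝ, ℂ)} (hg : ∀ ξ, ‖1 - 𝓕 g ξ‖ < 1)
    {f : ℝ → ℂ} (hf : Integrable f) (hfc : Continuous f) (hFf : Integrable (𝓕 f)) (x : ℝ) :
    Tendsto (fun n ↦ (residualFun g)^[n] f x) atTop (𝓝 0) := by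
  have hw : Continuous fun ξ ↦ 1 - 𝓕 g ξ := continuous_const.sub (𝓕 g).continuous
  refine squeeze_zero_norm (fun n ↦ ?_) (tendsto_integral_norm_pow_mul hFf hw hg)
  obtain ⟨h1, h2, h3⟩ := residualFun_iterate_of_integrable g hf hfc n
  have hF : Integrable (𝓕 ((residualFun g)^[n] f)) := by
    rw [funext h3]
    refine hFf.bdd_mul (c := 1) (hw.pow n).aestronglyMeasurable (ae_of_all _ fun ξ ↦ ?_)
    rw [norm_pow]
    exact pow_le_one₀ (norm_nonneg _) (hg ξ).le
  rw [← h2.fourierInv_fourier_eq h1 hF]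
  refine (VectorFourier.norm_fourierIntegral_le_integral_norm _ _ _ _ _).trans_eq ?_
  simp only [h3]

theorem tendsto_approxInv_apply {g : 𝓢(ℝ, ℂ)} (hg : ∀ ξ, ‖1 - 𝓕 g ξ‖ < 1)
    {f : ℝ → ℂ} (hf : Integrable f) (hFf : Integrable (𝓕 f)) (x : ℝ) :
    Tendsto (fun n ↦ approxInv (convFun g) n (convFun g f) x) atTop (𝓝 (𝓕⁻ (𝓕 f) x)) := by
  have hae := ae_eq_fourierInv_fourier hf hFf
  set h := 𝓕⁻ (𝓕 f) with hh
  have hhi : Integrable h := hf.congr hae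
  have hhc : Continuous h := continuous_fourierInv hFf
  have hFh : 𝓕 h = 𝓕 f := funext fun ξ ↦ (Real.fourier_congr_ae hae ξ).symm
  let V : Submodule ℂ (ℝ → ℂ) :=
    { carrier := {f | Integrable f volume}
      add_mem' := fun hv hw ↦ Integrable.add hv hw
      zero_mem' := integrable_zero _ _ _
      smul_mem' := fun c _ hv ↦ Integrable.smul c hv }
  have hlim := ((tendsto_add_atTop_iff_nat 1).2
    (tendsto_residualFun_iterate_apply hg hhi hhc (hFh ▸ hFf) x)).const_sub (h x)
  rw [sub_zero] at hlim
  refine hlim.congr fun n ↦ ?_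
  rw [convFun_congr_ae g hae, approxInv_eq_sub_iterate V (convFun g)
    (fun v hv ↦ integrable_convFun g hv) (fun v hv w hw ↦ convFun_add
      (convolutionExists_of_integrable g hv) (convolutionExists_of_integrable g hw))
    (fun c v _ ↦ convFun_smul g c v) n (show h ∈ V from hhi)]
  rfl

end Deconvolution
end

noncomputable section

namespace Deconvolution

/-! ### Gaussian kernels -/

theorem fourier_dilate_gaussian {φ : 𝓢(ℝ, ℂ)} {ε : ℝ} (hε : 0 < ε)
    (hφ : ∀ x : ℝ, φ x = ((1 / √(4 * Real.pi) * Real.exp (-(x / 2) ^ 2) : ℝ) : ℂ)) (ξ : ℝ) :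
    𝓕 (dilate ε hε φ) ξ = (Real.exp (-(4 * Real.pi ^ 2 * ε ^ 2) * ξ ^ 2) : ℝ) := by
  have hπ := Real.pi_pos
  -- This makes the dilated kernel `√b exp (-π b x²)`, with transform `exp (-π ξ² / b)`.
  set b : ℝ := (4 * Real.pi * ε ^ 2)⁻¹ with hb
  have hb0 : 0 < b := by positivity
  have hsb : √b = (ε * √(4 * Real.pi))⁻¹ := by
    rw [hb, Real.sqrt_inv, Real.sqrt_mul (by positivity), Real.sqrt_sq hε.le, mul_comm]
  have hfun : (dilate ε hε φ : ℝ → ℂ) =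
      fun x : ℝ ↦ (√b : ℂ) * Complex.exp (-Real.pi * (b : ℂ) * (x : ℂ) ^ 2) := by
    ext x
    rw [dilate_apply, hφ, hsb]
    have he : -Real.pi * (b : ℂ) * (x : ℂ) ^ 2 = ((-(x / ε / 2) ^ 2 : ℝ) : ℂ) := by
      rw [hb]
      push_cast
      field_simp
      ring
    rw [he, ← Complex.ofReal_exp, ← Complex.ofReal_mul, ← Complex.ofReal_mul]
    congr 1
    field_simp
  have hcpow : (b : ℂ) ^ (1 / 2 : ℂ) = (√b : ℂ) := by
    rw [Real.sqrt_eq_rpow, Complex.ofReal_cpow hb0.le]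
    norm_num
  have hF := congrFun (fourier_gaussian_pi (b := (b : ℂ)) (by simpa using hb0)) ξ
  have hsm : 𝓕 (fun x : ℝ ↦ (√b : ℂ) * Complex.exp (-Real.pi * (b : ℂ) * (x : ℂ) ^ 2)) ξ =
      (√b : ℂ) * 𝓕 (fun x : ℝ ↦ Complex.exp (-Real.pi * (b : ℂ) * (x : ℂ) ^ 2)) ξ := by
    simp only [Real.fourier_real_eq_integral_exp_smul, smul_eq_mul, ← integral_const_mul]
    refine integral_congr_ae (ae_of_all _ fun x ↦ ?_)
    simp only []
    ring
  have hs0 : (√b : ℂ) ≠ 0 := Complex.ofReal_ne_zero.2 (Real.sqrt_pos.2 hb0).ne'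
  rw [SchwartzMap.fourier_coe, hfun, hsm, hF, hcpow, ← mul_assoc, mul_one_div_cancel hs0, one_mul,
    Complex.ofReal_exp]
  congr 1
  rw [hb]
  push_cast
  field_simp

/-- The Bernstein polynomial `C(n, j) t ^ j (1 - t) ^ (n - j)`. -/
def bernsteinValue (n j : ℕ) (t : ℝ) : ℝ := n.choose j * t ^ j * (1 - t) ^ (n - j)

theorem bernsteinValue_nonneg (n j : ℕ) {t : ℝ} (h0 : 0 ≤ t) (h1 : t ≤ 1) :
    0 ≤ bernsteinValue n j t := by
  have := sub_nonneg.2 h1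
  unfold bernsteinValue
  positivity

/-- The Bernstein polynomials of degree `n` are nonnegative and sum to one. -/
theorem bernsteinValue_le_one (n j : ℕ) {t : ℝ} (h0 : 0 ≤ t) (h1 : t ≤ 1) :
    bernsteinValue n j t ≤ 1 := by
  rcases lt_or_ge n j with h | h
  · simp [bernsteinValue, Nat.choose_eq_zero_of_lt h]
  · have hsum : ∑ i ∈ Finset.range (n + 1), bernsteinValue n i t = 1 := by
      have := add_pow t (1 - t) n
      rw [add_sub_cancel, one_pow] at this
      rw [this]
      exact Finset.sum_congr rfl fun i _ ↦ by unfold bernsteinValue; ring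
    rw [← hsum]
    exact Finset.single_le_sum (fun i _ ↦ bernsteinValue_nonneg n i h0 h1)
      (Finset.mem_range.2 (Nat.lt_succ_of_le h))

/-- The factor `n - j` produced by differentiation is absorbed by `C(n, j) (n - j) = (j + 1) C(n, j
+ 1)`, so nothing grows with `n`. -/
theorem hasDerivAt_bernsteinValue_comp (n j : ℕ) {m : ℝ → ℝ} {c x : ℝ}
    (hm : HasDerivAt m (c * m x) x) :
    HasDerivAt (fun y ↦ bernsteinValue n j (m y))
      (c * (j * bernsteinValue n j (m x) - (j + 1) * bernsteinValue n (j + 1) (m x))) x := by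
  have h := ((hm.fun_pow j).const_mul (n.choose j : ℝ)).mul ((hm.const_sub 1).fun_pow (n - j))
  refine h.congr_deriv ?_
  have hch : (n.choose (j + 1) : ℝ) * (j + 1) = n.choose j * (n - j : ℕ) := by
    exact_mod_cast Nat.choose_succ_right_eq n j
  have hj : (j : ℝ) * m x ^ (j - 1) * m x = j * m x ^ j := by
    cases j with
    | zero => simp
    | succ j => rw [Nat.add_sub_cancel, pow_succ]; ring
  unfold bernsteinValue
  rw [← Nat.sub_sub]
  linear_combination (n.choose j : ℝ) * c * (1 - m x) ^ (n - j) * hj +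
    c * m x ^ (j + 1) * (1 - m x) ^ (n - j - 1) * hch

/-- The Gaussian multiplier `exp (-a ξ²)`, inserted into a Bernstein polynomial. -/
def bernsteinGaussian (a : ℝ) (n j : ℕ) (ξ : ℝ) : ℂ :=
  (bernsteinValue n j (Real.exp (-a * ξ ^ 2)) : ℝ)

theorem exp_neg_mul_sq_le_one {a : ℝ} (ha : 0 < a) (ξ : ℝ) : Real.exp (-a * ξ ^ 2) ≤ 1 :=
  Real.exp_le_one_iff.2 (by nlinarith [mul_nonneg ha.le (sq_nonneg ξ)])

theorem norm_bernsteinGaussian {a : ℝ} (ha : 0 < a) (n j : ℕ) (ξ : ℝ) :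
    ‖bernsteinGaussian a n j ξ‖ = bernsteinValue n j (Real.exp (-a * ξ ^ 2)) := by
  rw [bernsteinGaussian, Complex.norm_real, Real.norm_eq_abs,
    abs_of_nonneg (bernsteinValue_nonneg n j (Real.exp_pos _).le (exp_neg_mul_sq_le_one ha ξ))]

theorem hasTemperateGrowth_bernsteinGaussian {m : 𝓢(ℝ, ℂ)} {a : ℝ}
    (hm : ∀ ξ, m ξ = (Real.exp (-a * ξ ^ 2) : ℝ)) (n j : ℕ) :
    (bernsteinGaussian a n j).HasTemperateGrowth := by
  have h : bernsteinGaussian a n j =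
      fun ξ ↦ (n.choose j : ℂ) * m ξ ^ j * (1 - m ξ) ^ (n - j) := by
    ext ξ
    rw [hm, bernsteinGaussian, bernsteinValue]
    push_cast
    rfl
  rw [h]
  exact ((Function.HasTemperateGrowth.const _).mul (m.hasTemperateGrowth.pow j)).mul
    (((Function.HasTemperateGrowth.const 1).sub m.hasTemperateGrowth).pow (n - j))

/-- The multipliers `bernsteinGaussian a n j` tend to zero uniformly on compact sets. -/
theorem exists_tendsto_norm_bernsteinGaussian_le {a : ℝ} (ha : 0 < a) (j : ℕ) {R : ℝ}
    (hR : 0 < R) :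
    ∃ b : ℕ → ℝ, Tendsto b atTop (𝓝 0) ∧
      ∀ᶠ n in atTop, ∀ ξ, |ξ| ≤ R → ‖bernsteinGaussian a n j ξ‖ ≤ b n := by
  set q := 1 - Real.exp (-a * R ^ 2) with hq
  have hq1 : q < 1 := sub_lt_self _ (Real.exp_pos _)
  have hq0 : 0 < q := sub_pos.2 (Real.exp_lt_one_iff.2 (by nlinarith [mul_pos ha (pow_pos hR 2)]))
  -- From `C(n, j) ≤ n^j` and `1 - m ≤ q` on `|ξ| ≤ R`; geometric decay beats the power of `n`.
  refine ⟨fun n ↦ (n : ℝ) ^ j * q ^ n / q ^ j, ?_, ?_⟩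
  · simpa using (tendsto_pow_const_mul_const_pow_of_abs_lt_one j
      (abs_lt.2 ⟨by linarith, hq1⟩)).div_const (q ^ j)
  · filter_upwards [eventually_ge_atTop j] with n hn ξ hξ
    have he1 := exp_neg_mul_sq_le_one ha ξ
    have he : 1 - Real.exp (-a * ξ ^ 2) ≤ q := by
      refine sub_le_sub_left (Real.exp_le_exp.2 ?_) _
      have : ξ ^ 2 ≤ R ^ 2 := sq_le_sq' (abs_le.1 hξ).1 (abs_le.1 hξ).2
      nlinarith
    have hch : (n.choose j : ℝ) ≤ (n : ℝ) ^ j := by exact_mod_cast Nat.choose_le_pow n j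
    rw [norm_bernsteinGaussian ha, mul_div_assoc, div_eq_mul_inv, ← pow_sub₀ q hq0.ne' hn, bernsteinValue]
    have h1 : (n.choose j : ℝ) * Real.exp (-a * ξ ^ 2) ^ j ≤ (n : ℝ) ^ j :=
      (mul_le_of_le_one_right (Nat.cast_nonneg _)
        (pow_le_one₀ (Real.exp_pos _).le he1)).trans hch
    exact mul_le_mul h1 (pow_le_pow_left₀ (sub_nonneg.2 he1) he _)
      (pow_nonneg (sub_nonneg.2 he1) _) (by positivity)

theorem tendsto_seminorm_zero_bernsteinGaussian {m : 𝓢(ℝ, ℂ)} {a : ℝ} (ha : 0 < a)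
    (hm : ∀ ξ, m ξ = (Real.exp (-a * ξ ^ 2) : ℝ)) (k j : ℕ) (h : 𝓢(ℝ, ℂ)) :
    Tendsto (fun n ↦ SchwartzMap.seminorm ℂ k 0
      (SchwartzMap.smulLeftCLM ℂ (bernsteinGaussian a n j) h)) atTop (𝓝 0) := by
  rw [Metric.tendsto_nhds]
  intro δ hδ
  set C := SchwartzMap.seminorm ℂ (k + 1) 0 h
  set C' := SchwartzMap.seminorm ℂ k 0 h
  have hC : 0 ≤ C := apply_nonneg _ _
  have hC' : 0 ≤ C' := apply_nonneg _ _
  -- Beyond `R` one spare power of `|ξ|` gives the bound `C / R ≤ δ / 2`; the `+ 1` keeps `R`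
  -- positive when `C = 0`.
  set R := 2 * C / δ + 1
  have hR : 0 < R := by positivity
  obtain ⟨b, hb, hle⟩ := exists_tendsto_norm_bernsteinGaussian_le ha j hR
  have hb' : Tendsto (fun n ↦ C' * b n) atTop (𝓝 0) := by simpa using hb.const_mul C'
  filter_upwards [hle, hb'.eventually_le_const (half_pos hδ)] with n hn hbn
  rw [Real.dist_eq, sub_zero, abs_of_nonneg (apply_nonneg _ _)]
  refine lt_of_le_of_lt ?_ (half_lt_self hδ)
  refine SchwartzMap.seminorm_le_bound' ℂ k 0 _ (half_pos hδ).le fun ξ ↦ ?_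
  have h1 : |ξ| ^ (k + 1) * ‖h ξ‖ ≤ C := by simpa using SchwartzMap.le_seminorm' ℂ (k + 1) 0 h ξ
  have h2 : |ξ| ^ k * ‖h ξ‖ ≤ C' := by simpa using SchwartzMap.le_seminorm' ℂ k 0 h ξ
  rw [iteratedDeriv_zero,
    SchwartzMap.smulLeftCLM_apply_apply (hasTemperateGrowth_bernsteinGaussian hm n j), norm_smul,
    mul_left_comm, mul_comm]
  rcases le_or_gt |ξ| R with hξ | hξ
  · exact (mul_le_mul h2 (hn ξ hξ) (norm_nonneg _) hC').trans hbn
  · have hB : ‖bernsteinGaussian a n j ξ‖ ≤ 1 := by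
      rw [norm_bernsteinGaussian ha]
      exact bernsteinValue_le_one n j (Real.exp_pos _).le (exp_neg_mul_sq_le_one ha ξ)
    refine (mul_le_of_le_one_right (by positivity) hB).trans ?_
    have h3 : R * (|ξ| ^ k * ‖h ξ‖) ≤ C := by
      refine le_trans ?_ h1
      rw [pow_succ', mul_assoc]
      gcongr
    have h4 : C ≤ R * (δ / 2) := by
      have : R * (δ / 2) = C + δ / 2 := by simp only [R]; field_simp
      linarith
    exact le_of_mul_le_mul_left (h3.trans h4) hR

theorem seminorm_succ_le_seminorm_derivCLM (k l : ℕ) (h : 𝓢(ℝ, ℂ)) :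
    SchwartzMap.seminorm ℂ k (l + 1) h ≤
      SchwartzMap.seminorm ℂ k l (SchwartzMap.derivCLM ℂ ℂ h) := by
  refine SchwartzMap.seminorm_le_bound' ℂ k (l + 1) h (apply_nonneg _ _) fun x ↦ ?_
  rw [iteratedDeriv_succ']
  exact SchwartzMap.le_seminorm' ℂ k l (SchwartzMap.derivCLM ℂ ℂ h) x

theorem derivCLM_smulLeftCLM_bernsteinGaussian {m : 𝓢(ℝ, ℂ)} {a : ℝ}
    (hm : ∀ ξ, m ξ = (Real.exp (-a * ξ ^ 2) : ℝ)) (n j : ℕ) (h : 𝓢(ℝ, ℂ)) :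
    SchwartzMap.derivCLM ℂ ℂ (SchwartzMap.smulLeftCLM ℂ (bernsteinGaussian a n j) h) =
      SchwartzMap.smulLeftCLM ℂ (bernsteinGaussian a n j)
        (SchwartzMap.derivCLM ℂ ℂ h -
          (2 * a * j : ℂ) • SchwartzMap.smulLeftCLM ℂ (fun ξ : ℝ ↦ (ξ : ℂ)) h) +
      SchwartzMap.smulLeftCLM ℂ (bernsteinGaussian a n (j + 1))
        ((2 * a * (j + 1) : ℂ) • SchwartzMap.smulLeftCLM ℂ (fun ξ : ℝ ↦ (ξ : ℂ)) h) := by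
  ext ξ
  have hX : (fun ξ : ℝ ↦ (ξ : ℂ)).HasTemperateGrowth := Function.Complex.hasTemperateGrowth_ofReal
  have hB := hasTemperateGrowth_bernsteinGaussian hm n
  have hexp : HasDerivAt (fun y : ℝ ↦ Real.exp (-a * y ^ 2))
      (-(2 * a * ξ) * Real.exp (-a * ξ ^ 2)) ξ := by
    refine (((hasDerivAt_pow 2 ξ).const_mul (-a)).exp).congr_deriv ?_
    simp only [Nat.cast_ofNat, Nat.add_one_sub_one, pow_one]
    ring
  have hd : HasDerivAt (fun y ↦ bernsteinGaussian a n j y * h y) _ ξ :=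
    (hasDerivAt_bernsteinValue_comp n j hexp).ofReal_comp.mul (h.hasDerivAt ξ)
  have hfun : (SchwartzMap.smulLeftCLM ℂ (bernsteinGaussian a n j) h : ℝ → ℂ) =
      fun y ↦ bernsteinGaussian a n j y * h y := by
    ext y
    rw [SchwartzMap.smulLeftCLM_apply_apply (hB j), smul_eq_mul]
  rw [SchwartzMap.derivCLM_apply, hfun, hd.deriv, add_apply,
    SchwartzMap.smulLeftCLM_apply_apply (hB j), SchwartzMap.smulLeftCLM_apply_apply (hB (j + 1)),
    sub_apply, smul_apply, smul_apply, SchwartzMap.smulLeftCLM_apply_apply hX,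
    SchwartzMap.derivCLM_apply]
  simp only [bernsteinGaussian, smul_eq_mul]
  push_cast
  ring

/-- Induction on the number of derivatives; each one may raise `j` and multiply `h` by `ξ`, so both
must vary. -/
theorem tendsto_seminorm_bernsteinGaussian {m : 𝓢(ℝ, ℂ)} {a : ℝ} (ha : 0 < a)
    (hm : ∀ ξ, m ξ = (Real.exp (-a * ξ ^ 2) : ℝ)) (k l j : ℕ) (h : 𝓢(ℝ, ℂ)) :
    Tendsto (fun n ↦ SchwartzMap.seminorm ℂ k l
      (SchwartzMap.smulLeftCLM ℂ (bernsteinGaussian a n j) h)) atTop (𝓝 0) := by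
  induction l generalizing j h with
  | zero => exact tendsto_seminorm_zero_bernsteinGaussian ha hm k j h
  | succ l ih =>
    have hlim := (ih j (SchwartzMap.derivCLM ℂ ℂ h -
      (2 * a * j : ℂ) • SchwartzMap.smulLeftCLM ℂ (fun ξ : ℝ ↦ (ξ : ℂ)) h)).add
      (ih (j + 1) ((2 * a * (j + 1) : ℂ) • SchwartzMap.smulLeftCLM ℂ (fun ξ : ℝ ↦ (ξ : ℂ)) h))
    rw [add_zero] at hlim
    refine squeeze_zero (fun n ↦ apply_nonneg _ _) (fun n ↦ ?_) hlim
    refine (seminorm_succ_le_seminorm_derivCLM k l _).trans ?_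
    rw [derivCLM_smulLeftCLM_bernsteinGaussian hm]
    exact map_add_le_add _ _ _

/-- For a kernel with Gaussian Fourier transform, residual powers tend to zero in the Schwartz
space. -/
theorem tendsto_residual_pow_of_gaussian {g : 𝓢(ℝ, ℂ)} {a : ℝ} (ha : 0 < a)
    (hg : ∀ ξ, 𝓕 g ξ = (Real.exp (-a * ξ ^ 2) : ℝ)) (ψ : 𝓢(ℝ, ℂ)) :
    Tendsto (fun n ↦ (residual g ^ n) ψ) atTop (𝓝 0) := by
  have h : Tendsto (fun n ↦ SchwartzMap.smulLeftCLM ℂ (bernsteinGaussian a n 0) (𝓕 ψ)) atTop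
      (𝓝 0) := by
    rw [(schwartz_withSeminorms ℂ ℝ ℂ).tendsto_nhds]
    intro i δ hδ
    simp only [sub_zero]
    exact (tendsto_seminorm_bernsteinGaussian ha hg i.1 i.2 0 (𝓕 ψ)).eventually_lt_const hδ
  have h2 := ((FourierTransform.fourierInvCLM ℂ 𝓢(ℝ, ℂ)).continuous.tendsto 0).comp h
  rw [map_zero] at h2
  refine h2.congr fun n ↦ ?_
  have h3 : SchwartzMap.smulLeftCLM ℂ (bernsteinGaussian a n 0) (𝓕 ψ) =
      𝓕 ((residual g ^ n) ψ) := by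
    ext ξ
    rw [fourier_residual_pow_apply,
      SchwartzMap.smulLeftCLM_apply_apply (hasTemperateGrowth_bernsteinGaussian hg n 0), hg,
      bernsteinGaussian, bernsteinValue]
    simp
  rw [Function.comp_apply, h3, FourierTransform.fourierInvCLM_apply,
    FourierTransform.fourierInv_fourier_eq]

end Deconvolution
end

/-! ### The four claims assembled -/

theorem mainTheorem1 (φ : 𝓢(ℝ, ℂ)) (ε : ℝ) (hε : 0 < ε)
    (hφ : ∀ ξ : ℝ, ∃ r : ℝ, 0 < r ∧ r < 2 ∧
      𝓕 (dilate ε hε φ : ℝ → ℂ) ξ = (r : ℂ)) :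
    -- (1) convergence in `L²`
    (∀ f : ℝ → ℂ, MemLp f 2 volume →
      (∀ k : ℕ,
        MemLp ((convFun (dilate ε hε φ))^[k] f) 2 volume ∧
        ConvolutionExists ((convFun (dilate ε hε φ))^[k] f)
          (dilate ε hε φ : ℝ → ℂ) (ContinuousLinearMap.mul ℂ ℂ) volume) ∧
      Tendsto
        (fun n : ℕ ↦ eLpNorm
          (approxInv (convFun (dilate ε hε φ)) n
            (convFun (dilate ε hε φ) f) - f) 2 volume)
        atTop (𝓝 0)) ∧
    -- (2) pointwise convergence
    (∀ f : ℝ → ℂ, Integrable f volume → Integrable (𝓕 f) volume →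
      (∀ k : ℕ,
        Integrable ((convFun (dilate ε hε φ))^[k] f) volume ∧
        ConvolutionExists ((convFun (dilate ε hε φ))^[k] f)
          (dilate ε hε φ : ℝ → ℂ) (ContinuousLinearMap.mul ℂ ℂ) volume) ∧
      (∃ g : ℝ → ℂ, Continuous g ∧ f =ᵐ[volume] g ∧ ∀ x : ℝ,
        Tendsto
          (fun n : ℕ ↦
            approxInv (convFun (dilate ε hε φ)) n
              (convFun (dilate ε hε φ) f) x)
          atTop (𝓝 (g x))) ∧
      (∀ x : ℝ, ContinuousAt f x →
        Tendsto
          (fun n : ℕ ↦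
            approxInv (convFun (dilate ε hε φ)) n
              (convFun (dilate ε hε φ) f) x)
          atTop (𝓝 (f x)))) ∧
    -- (3) convergence in `𝓢'` for `1`, `δ`, `pv (1/x)`, `e^{2πiyx}`, and for all finite linear
    -- combinations of translates of these
    ((∀ u ∈ basicDists,
      Tendsto
        (fun n : ℕ ↦
          approxInv (convTempered (dilate ε hε φ)) n
            (convTempered (dilate ε hε φ) u))
        atTop (𝓝 u)) ∧
     (∀ u ∈ Submodule.span ℂ
        {v : 𝓢'(ℝ, ℂ) | ∃ a : ℝ, ∃ w ∈ basicDists, v = translateDist a w},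
      Tendsto
        (fun n : ℕ ↦
          approxInv (convTempered (dilate ε hε φ)) n
            (convTempered (dilate ε hε φ) u))
        atTop (𝓝 u))) ∧
    -- (4) the Gaussian kernel: convergence in `𝓢` and in `𝓢'`
    ((∀ x : ℝ, φ x = ((1 / Real.sqrt (4 * Real.pi) * Real.exp (-(x / 2) ^ 2) : ℝ) : ℂ)) →
      (∀ f : 𝓢(ℝ, ℂ),
        Tendsto
          (fun n : ℕ ↦
            approxInv (convSchwartz (dilate ε hε φ)) n
              (convSchwartz (dilate ε hε φ) f))
          atTop (𝓝 f)) ∧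
      (∀ f : 𝓢'(ℝ, ℂ),
        Tendsto
          (fun n : ℕ ↦
            approxInv (convTempered (dilate ε hε φ)) n
              (convTempered (dilate ε hε φ) f))
          atTop (𝓝 f))) := by
  have hF : ∀ ξ, ‖1 - 𝓕 (dilate ε hε φ) ξ‖ < 1 := fun ξ ↦ by
    obtain ⟨r, hr0, hr2, hr⟩ := hφ ξ
    rw [SchwartzMap.fourier_coe, hr, ← Complex.ofReal_one, ← Complex.ofReal_sub,
      Complex.norm_real, Real.norm_eq_abs, abs_lt]
    constructor <;> linarith
  have hF' : ∀ ξ, ‖1 - 𝓕 (reflect (dilate ε hε φ)) ξ‖ < 1 := fun ξ ↦ by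
    rw [fourier_reflect_apply]
    exact hF (-ξ)
  refine ⟨fun f hf ↦ ⟨fun k ↦ ?_, tendsto_eLpNorm_approxInv_sub hF hf⟩,
    fun f hf hFf ↦ ⟨fun k ↦ ?_, ?_, fun x hx ↦ ?_⟩, ⟨fun u hu ↦ ?_, fun u hu ↦ ?_⟩,
    fun hgauss ↦ ⟨fun f ↦ ?_, fun f ↦ ?_⟩⟩
  · have h := memLp_convFun_iterate hF hf k
    exact ⟨h, convolutionExists_of_memLp_two _ h⟩
  · have h := integrable_convFun_iterate (dilate ε hε φ) hf k
    exact ⟨h, convolutionExists_of_integrable _ h⟩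
  · exact ⟨𝓕⁻ (𝓕 f), continuous_fourierInv hFf, ae_eq_fourierInv_fourier hf hFf,
      tendsto_approxInv_apply hF hf hFf⟩
  -- At a continuity point of `f`, Fourier inversion identifies the limit with `f x`.
  · rw [← hf.fourierInv_fourier_eq hFf hx]
    exact tendsto_approxInv_apply hF hf hFf x
  · exact (tendsto_approxInv_convTempered_iff _ u).2 (tendsto_basicDists_residual_pow hF' hu)
  · exact (tendsto_approxInv_convTempered_iff _ u).2 (tendsto_span_translates_residual_pow hF' hu)
  · have h := ((tendsto_add_atTop_iff_nat 1).2 (tendsto_residual_pow_of_gaussian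
      (by positivity) (fourier_dilate_gaussian hε hgauss) f)).const_sub f
    simpa only [approxInv_convSchwartz, sub_zero] using h
  · refine (tendsto_approxInv_convTempered_iff _ f).2 fun ψ ↦ ?_
    have h := tendsto_residual_pow_of_gaussian (g := reflect (dilate ε hε φ))
      (a := 4 * Real.pi ^ 2 * ε ^ 2) (by positivity) (fun ξ ↦ by
        rw [fourier_reflect_apply, fourier_dilate_gaussian hε hgauss, neg_sq]) ψ
    simpa only [Function.comp_def, map_zero] using ((map_continuous f).tendsto 0).comp h
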